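/- Let $I\subseteq\mathbb R$ be open and let $r=r(s)$, $t=t(s)$ be real functions of class $C^3$ on $I$ with $1-r't'\neq0$ on $I$. On the jet space $\mathcal J=\{(x,y,z,p,q,s): s\in I\}$ of the system $z_{xx}=r(z_{xy})$, $z_{yy}=t(z_{xy})$ put $\omega_1=dq-s\,dx-t\,dy$, $\omega_2=ds$, $\omega_3=dz-p\,dx-q\,dy$, $\omega_4=dp-r\,dx-s\,dy$, $$g_0=2(1-r't')\,\omega_2\omega_3+t'\,\omega_4^2-2\,\omega_1\omega_4+r'\,\omega_1^2 ,$$ and let $H^+$ be the distribution spanned by $D_x=\partial_x+p\,\partial_z+r\,\partial_p+s\,\partial_q$ and $D_y=\partial_y+q\,\partial_z+s\,\partial_p+t\,\partial_q$. (1) The leaf space $\mathcal S=\mathcal J/H^+$ (the solution space of the system) is $\mathbb R^3\times I$ with coordinates $(z,p,q,s)$ taken at the point where the leaf meets $x=y=0$; the projection $\pi:\mathcal J\to\mathcal S$ is a $C^3$ surjective submersion with $\ker d\pi=H^+$, its fibres are the leaves of $H^+$, and $d\pi(\partial_z)=\partial_z$. (2) For every open $J\subseteq I$ and every $h=h(s)$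 of class $C^2$ on $J$, the form $e^{2h}g_0$ over $J$ is the pullback under $\pi$ of a $C^2$ pseudo-Riemannian metric $g$ on $\mathbb R^3\times J$. At each point $g$ has split signature $(2,2)$ iff $1-r't'>0$ and Lorentzian signature ($(3,1)$ or $(1,3)$) iff $1-r't'<0$. The vector field $\partial_z$ is null and covariantly constant for $g$; in particular, where $1-r't'<0$, $g$ is a pp-wave (a Lorentzian metric with a nowhere zero covariantly constant null vector field), and where $1-r't'>0$ it is the split-signature analogue. The metric $g$ is Ricci-flat if and only if on $J$ $$h''=h'^2-\frac{(t'r')'}{1-r't'}\,h'+\frac{2\big(r^{(3)}t'+t^{(3)}r'\big)(1-r't')+2r''t''+4r't'r''t''+3t'^2r''^2+3r'^2t''^2}{8(1-r't')^2}.$$ The metric $g$ is conformally flat (each point has an open neighbourhood on which $e^{2f}g$ has zero curvature for some $C^2$ function $f$) if and only if on $J$ $$r^{(3)}=\frac{-3r''(r't')'}{2(1-r't')},\qquad t^{(3)}=\frac{-3t''(r't')'}{2(1-r't')}.$$ (3) For every $s_0\in I$ and all $a,b\in\mathbb R$ there are $\delta>0$ with $(s_0-\delta,s_0+\delta)\subseteq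 I$ and a $C^2$ function $h$ on $(s_0-\delta,s_0+\delta)$ with $h(s_0)=a$, $h'(s_0)=b$ that solves the above second order ODE, so that $g$ is Ricci-flat over this interval. If $r,t$ are of class $C^{k+3}$ on $I$ ($0\le k\le\infty$), then $h$ is of class $C^{k+2}$. (4) There are $C^\infty$ functions $r,t$ on $\mathbb R$, a non-empty open interval $J$ on which $1-r't'<0$, and a $C^\infty$ function $h$ on $J$, such that $g$ is a Ricci-flat pp-wave on $\mathbb R^3\times J$ that is not conformally flat on any non-empty open subset. The same holds with $1-r't'>0$ on $J$ and the split-signature analogue of a pp-wave. -/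

import Mathlib

noncomputable section

namespace ParaCR

/-! ## Pseudo-Riemannian geometry in a global chart of `ℝⁿ`

A metric is given by its matrix of components `g m i j` at the point `m`. -/

section Geometry

variable {n : ℕ}

/-- Partial derivative `∂_i f` at `m`. -/
def pd (i : Fin n) (f : (Fin n → ℝ) → ℝ) (m : Fin n → ℝ) : ℝ :=
  fderiv ℝ f m (Pi.single i 1)

/-- `g` is a pseudo-Riemannian metric of class `C²` on `U`. -/
def IsMetricOn (g : (Fin n → ℝ) → Matrix (Fin n) (Fin n) ℝ) (U : Set (Fin n → ℝ)) : Prop :=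
  (∀ i j, ContDiffOn ℝ 2 (fun m => g m i j) U) ∧
    ∀ m ∈ U, (g m).IsSymm ∧ (g m).det ≠ 0

/-- Christoffel symbols `Γ^k_{ij}` of the Levi-Civita connection. -/
def christoffel (g : (Fin n → ℝ) → Matrix (Fin n) (Fin n) ℝ) (k i j : Fin n)
    (m : Fin n → ℝ) : ℝ :=
  (1 / 2) * ∑ l, (g m)⁻¹ k l *
    (pd i (fun x => g x j l) m + pd j (fun x => g x i l) m - pd l (fun x => g x i j) m)

/-- Components `R^l_{kij}` of the Riemann tensor: `R(∂_i, ∂_j) ∂_k = R^l_{kij} ∂_l`. -/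
def riemann (g : (Fin n → ℝ) → Matrix (Fin n) (Fin n) ℝ) (l k i j : Fin n)
    (m : Fin n → ℝ) : ℝ :=
  pd i (christoffel g l j k) m - pd j (christoffel g l i k) m +
    ∑ a, (christoffel g l i a m * christoffel g a j k m -
      christoffel g l j a m * christoffel g a i k m)

/-- Components `R_{kj} = R^i_{kij}` of the Ricci tensor. -/
def ricci (g : (Fin n → ℝ) → Matrix (Fin n) (Fin n) ℝ) (k j : Fin n) (m : Fin n → ℝ) : ℝ :=
  ∑ i, riemann g i k i j m

def RicciFlatOn (g : (Fin n → ℝ) → Matrix (Fin n) (Fin n) ℝ) (U : Set (Fin n → ℝ)) : Prop :=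
  ∀ m ∈ U, ∀ k j, ricci g k j m = 0

/-- The curvature of `g` vanishes on `U`. -/
def FlatOn (g : (Fin n → ℝ) → Matrix (Fin n) (Fin n) ℝ) (U : Set (Fin n → ℝ)) : Prop :=
  ∀ m ∈ U, ∀ l k i j, riemann g l k i j m = 0

/-- Every point of `U` has an open neighbourhood `V` in `U` on which some conformal rescaling
`e^{2f} g` is flat. -/
def ConformallyFlatOn (g : (Fin n → ℝ) → Matrix (Fin n) (Fin n) ℝ)
    (U : Set (Fin n → ℝ)) : Prop :=
  ∀ m ∈ U, ∃ V : Set (Fin n → ℝ), IsOpen V ∧ m ∈ V ∧ V ⊆ U ∧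
    ∃ f : (Fin n → ℝ) → ℝ, ContDiffOn ℝ 2 f V ∧
      FlatOn (fun x => Real.exp (2 * f x) • g x) V

/-- Components `(∇_i X)^k` of the covariant derivative of the vector field `X`. -/
def covDeriv (g : (Fin n → ℝ) → Matrix (Fin n) (Fin n) ℝ) (X : (Fin n → ℝ) → (Fin n → ℝ))
    (i k : Fin n) (m : Fin n → ℝ) : ℝ :=
  pd i (fun x => X x k) m + ∑ j, christoffel g k i j m * X m j

/-- `X` is a nowhere zero, null, covariantly constant vector field on `U`. -/
def IsParallelNullOn (g : (Fin n → ℝ) → Matrix (Fin n) (Fin n) ℝ) (U : Set (Fin n → ℝ))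
    (X : (Fin n → ℝ) → (Fin n → ℝ)) : Prop :=
  ContDiffOn ℝ 1 X U ∧
    ∀ m ∈ U, X m ≠ 0 ∧ X m ⬝ᵥ (g m).mulVec (X m) = 0 ∧ ∀ i k, covDeriv g X i k m = 0

/-- The symmetric matrix `M` is nondegenerate with `a` plus signs and `b` minus signs. -/
def HasSignature (M : Matrix (Fin n) (Fin n) ℝ) (a b : ℕ) : Prop :=
  ∃ (P : Matrix (Fin n) (Fin n) ℝ) (ε : Fin n → ℝ), IsUnit P.det ∧
    (∀ i, ε i = 1 ∨ ε i = -1) ∧ Set.ncard {i | ε i = 1} = a ∧ Set.ncard {i | ε i = -1} = b ∧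
      P.transpose * M * P = Matrix.diagonal ε

/-- Split (neutral) signature in dimension four. -/
def IsSplit (M : Matrix (Fin 4) (Fin 4) ℝ) : Prop := HasSignature M 2 2

/-- Lorentzian signature in dimension four, with either sign convention. -/
def IsLorentzian (M : Matrix (Fin 4) (Fin 4) ℝ) : Prop :=
  HasSignature M 3 1 ∨ HasSignature M 1 3

/-- A pp-wave: a Lorentzian metric with a covariantly constant null vector field. -/
def IsPPWaveOn (g : (Fin 4 → ℝ) → Matrix (Fin 4) (Fin 4) ℝ) (U : Set (Fin 4 → ℝ)) : Prop :=
  IsMetricOn g U ∧ (∀ m ∈ U, IsLorentzian (g m)) ∧ ∃ X, IsParallelNullOn g U X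

/-- The split-signature analogue of a pp-wave. -/
def IsSplitPPWaveOn (g : (Fin 4 → ℝ) → Matrix (Fin 4) (Fin 4) ℝ)
    (U : Set (Fin 4 → ℝ)) : Prop :=
  IsMetricOn g U ∧ (∀ m ∈ U, IsSplit (g m)) ∧ ∃ X, IsParallelNullOn g U X

end Geometry

/-! ## The jet space of `z_xx = r(z_xy)`, `z_yy = t(z_xy)`

Points are `u = (x, y, z, p, q, s)`, numbered `0, …, 5`; tangent vectors `v` likewise. -/

/-- The part of the jet space over `s ∈ I`. -/
def jetDomain (I : Set ℝ) : Set (Fin 6 → ℝ) := {u | u 5 ∈ I}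

/-- `ω₁ = dq - s dx - t dy`. -/
def omega1 (t : ℝ → ℝ) (u v : Fin 6 → ℝ) : ℝ := v 4 - u 5 * v 0 - t (u 5) * v 1

/-- `ω₂ = ds`. -/
def omega2 (v : Fin 6 → ℝ) : ℝ := v 5

/-- `ω₃ = dz - p dx - q dy`. -/
def omega3 (u v : Fin 6 → ℝ) : ℝ := v 2 - u 3 * v 0 - u 4 * v 1

/-- `ω₄ = dp - r dx - s dy`. -/
def omega4 (r : ℝ → ℝ) (u v : Fin 6 → ℝ) : ℝ := v 3 - r (u 5) * v 0 - u 5 * v 1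

/-- `D_x = ∂_x + p ∂_z + r ∂_p + s ∂_q`. -/
def totalDx (r : ℝ → ℝ) (u : Fin 6 → ℝ) : Fin 6 → ℝ := ![1, 0, u 3, r (u 5), u 5, 0]

/-- `D_y = ∂_y + q ∂_z + s ∂_p + t ∂_q`. -/
def totalDy (t : ℝ → ℝ) (u : Fin 6 → ℝ) : Fin 6 → ℝ := ![0, 1, u 4, u 5, t (u 5), 0]

/-- The (degenerate) symmetric bilinear form
`g₀ = 2 (1 - r't') ω₂ ω₃ + t' ω₄² - 2 ω₁ ω₄ + r' ω₁²` on the jet space,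
where `2 α β = α ⊗ β + β ⊗ α`. -/
def jetForm (r t : ℝ → ℝ) (u v w : Fin 6 → ℝ) : ℝ :=
  (1 - deriv r (u 5) * deriv t (u 5)) * (omega2 v * omega3 u w + omega3 u v * omega2 w)
    + deriv t (u 5) * (omega4 r u v * omega4 r u w)
    - (omega1 t u v * omega4 r u w + omega4 r u v * omega1 t u w)
    + deriv r (u 5) * (omega1 t u v * omega1 t u w)

/-- `g = e^{2h} g₀` on the jet space. -/
def jetMetric (r t h : ℝ → ℝ) (u v w : Fin 6 → ℝ) : ℝ :=
  Real.exp (2 * h (u 5)) * jetForm r t u v w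

/-- `u` and `u'` lie on one leaf of the distribution `H⁺ = span (D_x, D_y)` over `I`: a `C¹` curve
tangent to `H⁺` joins them. -/
def SameLeaf (r t : ℝ → ℝ) (I : Set ℝ) (u u' : Fin 6 → ℝ) : Prop :=
  ∃ (c : ℝ → Fin 6 → ℝ) (a b : ℝ → ℝ), Continuous a ∧ Continuous b ∧ c 0 = u ∧ c 1 = u' ∧
    ∀ τ ∈ Set.Icc (0 : ℝ) 1, c τ ∈ jetDomain I ∧
      HasDerivWithinAt c (a τ • totalDx r (c τ) + b τ • totalDy t (c τ)) (Set.Icc 0 1) τ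

/-! ## The solution space (the leaf space of `H⁺`)

The leaf through a point is determined by `s` and by the values `(z, p, q)` where the leaf meets
`x = y = 0`. Points of the solution space are `m = (z, p, q, s)`, numbered `0, …, 3`. -/

/-- The part of the solution space over `s ∈ J`. -/
def solDomain (J : Set ℝ) : Set (Fin 4 → ℝ) := {m | m 3 ∈ J}

/-- The projection of the jet space onto the solution space. -/
def proj (r t : ℝ → ℝ) (u : Fin 6 → ℝ) : Fin 4 → ℝ :=
  ![u 2 - u 0 * u 3 - u 1 * u 4 +
      (r (u 5) * u 0 ^ 2 / 2 + u 5 * u 0 * u 1 + t (u 5) * u 1 ^ 2 / 2),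
    u 3 - r (u 5) * u 0 - u 5 * u 1,
    u 4 - u 5 * u 0 - t (u 5) * u 1,
    u 5]

/-- The linear section `x = y = 0` of the projection. -/
def sec (m : Fin 4 → ℝ) : Fin 6 → ℝ := ![0, 0, m 0, m 1, m 2, m 3]

/-- The components on the solution space of the metric `g = e^{2h} g₀`, computed along the
section `x = y = 0`. -/
def solMetric (r t h : ℝ → ℝ) (m : Fin 4 → ℝ) : Matrix (Fin 4) (Fin 4) ℝ :=
  Matrix.of fun i j =>
    jetMetric r t h (sec m) (sec (Pi.single i 1)) (sec (Pi.single j 1))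

/-- The second order ODE for the conformal exponent `h` at `s`. -/
def RicciODE (r t h : ℝ → ℝ) (s : ℝ) : Prop :=
  iteratedDeriv 2 h s =
    deriv h s ^ 2
      - deriv (fun x => deriv t x * deriv r x) s / (1 - deriv r s * deriv t s) * deriv h s
      + (2 * (iteratedDeriv 3 r s * deriv t s + iteratedDeriv 3 t s * deriv r s)
            * (1 - deriv r s * deriv t s)
          + 2 * iteratedDeriv 2 r s * iteratedDeriv 2 t s
          + 4 * deriv r s * deriv t s * iteratedDeriv 2 r s * iteratedDeriv 2 t s
          + 3 * deriv t s ^ 2 * iteratedDeriv 2 r s ^ 2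
          + 3 * deriv r s ^ 2 * iteratedDeriv 2 t s ^ 2)
        / (8 * (1 - deriv r s * deriv t s) ^ 2)

/-- The pair of third order ODEs for `r` and `t` at `s` that expresses conformal flatness. -/
def FlatnessODEs (r t : ℝ → ℝ) (s : ℝ) : Prop :=
  iteratedDeriv 3 r s = -3 * iteratedDeriv 2 r s * deriv (fun x => deriv r x * deriv t x) s
      / (2 * (1 - deriv r s * deriv t s)) ∧
  iteratedDeriv 3 t s = -3 * iteratedDeriv 2 t s * deriv (fun x => deriv r x * deriv t x) s
      / (2 * (1 - deriv r s * deriv t s))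

end ParaCR

end

open ParaCR
open scoped ContDiff

noncomputable section

namespace ParaCR

/-! Along a leaf of `H⁺` the value of `s` is constant, so `p`, `q` are affine and `z` is quadratic
in `(x, y)`. Sliding to `x = y = 0` gives the explicit quotient map `proj`. Its differential is the
coframe `ω₃, ω₄, ω₁, ω₂` up to `x, y`-dependent multiples that cancel in `g₀` (`jetMetric_eq`), so
the form descends.

With `D = 1 - r't'`, downstairs `g = e^{2h}(2D dz ds + t' dp² - 2 dp dq + r' dq²)` depends on `s`
only. Its Christoffel symbols are a scalar `κ = Γ^s_ss`, a 2×2 matrix `K = (Γ^a_bs)` and a symmetric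
2×2 matrix `e = (Γ^z_ab)`, with `a, b` in `{p, q}`. None has a lower index `z`, so `∂_z` is
parallel. The determinant is `e^{8h} D³`; as `∂_z` is null, its sign decides between split and
Lorentzian signature.

The only Ricci component that can be nonzero is `R_ss = κ tr K - tr K' - tr K²`, which is `-2` times
the defect of the ODE for `h`. The off-diagonal entries of `K' - κK + K²` do not change under any
conformal factor, and their vanishing is the pair of ODEs for `r` and `t`
(`flatnessODEs_of_flatOn`). Conversely, given these ODEs, a factor solving the Ricci ODE makes the
metric flat (`flatOn_solMetric`).

The Ricci ODE is a Riccati equation for `w = h'`. Picard–Lindelöf, an integration and a bootstrap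
give `h` with its regularity (`exists_ricciODE_solution`). For the examples, `r = s²`, `t = s` has
`D = 1 - 2s`, which takes both signs, and violates the flatness ODEs wherever `D ≠ 0`. -/

/-! ### Plane-wave Christoffel arrays and their curvature -/

/-- The array of Christoffel symbols of a plane wave in coordinates `(z, p, q, s)` in which the
metric depends on `s` only. -/
def waveSymbol (κ k11 k12 k21 k22 e11 e12 e22 : ℝ) : Fin 4 → Matrix (Fin 4) (Fin 4) ℝ :=
  ![!![0, 0, 0, 0; 0, e11, e12, 0; 0, e12, e22, 0; 0, 0, 0, 0],
    !![0, 0, 0, 0; 0, 0, 0, k11; 0, 0, 0, k12; 0, k11, k12, 0],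
    !![0, 0, 0, 0; 0, 0, 0, k21; 0, 0, 0, k22; 0, k21, k22, 0],
    !![0, 0, 0, 0; 0, 0, 0, 0; 0, 0, 0, 0; 0, 0, 0, κ]]

/-- The Riemann tensor computed from symbols `Γ` that depend on `x³` only, with derivative `Γ'`. -/
def symbolCurvature (Γ Γ' : Fin 4 → Matrix (Fin 4) (Fin 4) ℝ) (l k i j : Fin 4) : ℝ :=
  (if i = 3 then Γ' l j k else 0) - (if j = 3 then Γ' l i k else 0)
    + ∑ a, (Γ l i a * Γ a j k - Γ l j a * Γ a i k)

theorem hasDerivAt_waveSymbol {κ k11 k12 k21 k22 e11 e12 e22 : ℝ → ℝ}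
    {κ' k11' k12' k21' k22' e11' e12' e22' s : ℝ} (hκ : HasDerivAt κ κ' s)
    (h11 : HasDerivAt k11 k11' s) (h12 : HasDerivAt k12 k12' s) (h21 : HasDerivAt k21 k21' s)
    (h22 : HasDerivAt k22 k22' s) (he11 : HasDerivAt e11 e11' s) (he12 : HasDerivAt e12 e12' s)
    (he22 : HasDerivAt e22 e22' s) (l i j : Fin 4) :
    HasDerivAt (fun x => waveSymbol (κ x) (k11 x) (k12 x) (k21 x) (k22 x) (e11 x) (e12 x) (e22 x)
      l i j) (waveSymbol κ' k11' k12' k21' k22' e11' e12' e22' l i j) s := by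
  fin_cases l <;> fin_cases i <;> fin_cases j <;> simp [waveSymbol] <;>
    first | exact hasDerivAt_const s (0 : ℝ) | assumption

/-- In matrix form the hypotheses read `K' = κK - K²` and `e' = eK`. Since `e` is symmetric, the
second is four equations for three unknowns. -/
theorem symbolCurvature_waveSymbol_eq_zero
    {κ k11 k12 k21 k22 e11 e12 e22 κ' k11' k12' k21' k22' e11' e12' e22' : ℝ}
    (h11 : k11' = κ * k11 - (k11 * k11 + k12 * k21))
    (h12 : k12' = κ * k12 - (k11 * k12 + k12 * k22))
    (h21 : k21' = κ * k21 - (k21 * k11 + k22 * k21))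
    (h22 : k22' = κ * k22 - (k21 * k12 + k22 * k22))
    (he11 : e11' = e11 * k11 + e12 * k21)
    (he12 : e12' = e11 * k12 + e12 * k22)
    (he21 : e12' = e12 * k11 + e22 * k21)
    (he22 : e22' = e12 * k12 + e22 * k22) (l k i j : Fin 4) :
    symbolCurvature (waveSymbol κ k11 k12 k21 k22 e11 e12 e22)
      (waveSymbol κ' k11' k12' k21' k22' e11' e12' e22') l k i j = 0 := by
  fin_cases l <;> fin_cases k <;> fin_cases i <;> fin_cases j <;>
    simp [symbolCurvature, waveSymbol, Fin.sum_univ_four] <;> linarith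

theorem sum_symbolCurvature_waveSymbol
    (κ k11 k12 k21 k22 e11 e12 e22 κ' k11' k12' k21' k22' e11' e12' e22' : ℝ) (k j : Fin 4) :
    ∑ i, symbolCurvature (waveSymbol κ k11 k12 k21 k22 e11 e12 e22)
      (waveSymbol κ' k11' k12' k21' k22' e11' e12' e22') i k i j =
    if k = 3 ∧ j = 3 then
      κ * (k11 + k22) - (k11' + k22') - (k11 * k11 + 2 * (k12 * k21) + k22 * k22) else 0 := by
  fin_cases k <;> fin_cases j <;>
    simp [symbolCurvature, waveSymbol, Fin.sum_univ_four] <;> ring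

theorem pd_comp_last {φ : ℝ → ℝ} {φ' : ℝ} {m : Fin 4 → ℝ} (h : HasDerivAt φ φ' (m 3))
    (i : Fin 4) : pd i (fun x => φ (x 3)) m = if i = 3 then φ' else 0 := by
  have h1 : HasFDerivAt (fun x : Fin 4 → ℝ => φ (x 3))
      (φ' • (ContinuousLinearMap.proj 3 : (Fin 4 → ℝ) →L[ℝ] ℝ)) m :=
    h.comp_hasFDerivAt m (ContinuousLinearMap.proj (R := ℝ) (φ := fun _ : Fin 4 => ℝ) 3).hasFDerivAt
  rw [pd, h1.fderiv]
  simp [Pi.single_apply, eq_comm]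

theorem pd_congr {n : ℕ} {i : Fin n} {f g : (Fin n → ℝ) → ℝ} {m : Fin n → ℝ}
    (h : f =ᶠ[nhds m] g) : pd i f m = pd i g m := by
  rw [pd, pd, h.fderiv_eq]

theorem isOpen_solDomain {J : Set ℝ} (hJ : IsOpen J) : IsOpen (solDomain J) :=
  hJ.preimage (continuous_apply 3)

/-! ### The metric on the solution space and its Christoffel symbols -/

/-- The matrix of `solMetric` at a point where `e^{2h} = E`, `r' = r₁`, `t' = t₁`. -/
def waveMatrix (E r₁ t₁ : ℝ) : Matrix (Fin 4) (Fin 4) ℝ :=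
  !![0, 0, 0, E * (1 - r₁ * t₁); 0, E * t₁, -E, 0; 0, -E, E * r₁, 0; E * (1 - r₁ * t₁), 0, 0, 0]

theorem solMetric_eq (r t h : ℝ → ℝ) (m : Fin 4 → ℝ) :
    solMetric r t h m =
      waveMatrix (Real.exp (2 * h (m 3))) (deriv r (m 3)) (deriv t (m 3)) := by
  ext i j
  fin_cases i <;> fin_cases j <;>
    simp [solMetric, waveMatrix, jetMetric, jetForm, omega1, omega2, omega3, omega4, sec]

theorem waveMatrix_inv {E r₁ t₁ : ℝ} (hE : E ≠ 0) (hD : 1 - r₁ * t₁ ≠ 0) :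
    (waveMatrix E r₁ t₁)⁻¹ = (E * (1 - r₁ * t₁))⁻¹ •
      !![0, 0, 0, 1; 0, -r₁, -1, 0; 0, -1, -t₁, 0; 1, 0, 0, 0] := by
  apply Matrix.inv_eq_right_inv
  -- With the inverse kept as an atom `w` subject to this relation, each entry becomes a polynomial
  -- identity.
  have hw := mul_inv_cancel₀ (mul_ne_zero hE hD)
  generalize (E * (1 - r₁ * t₁))⁻¹ = w at hw
  ext i j
  fin_cases i <;> fin_cases j <;>
    simp [waveMatrix, Matrix.mul_apply, Fin.sum_univ_four] <;>
    first | linear_combination hw | ring1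

theorem det_waveMatrix (E r₁ t₁ : ℝ) :
    (waveMatrix E r₁ t₁).det = E ^ 4 * (1 - r₁ * t₁) ^ 3 := by
  rw [waveMatrix]
  simp [Matrix.det_succ_row_zero, Fin.sum_univ_succ, Fin.succAbove]
  ring

theorem waveMatrix_isSymm (E r₁ t₁ : ℝ) : (waveMatrix E r₁ t₁).IsSymm := by
  ext i j
  fin_cases i <;> fin_cases j <;> simp [waveMatrix]

/-- Derivative of the entries of `waveMatrix` along `s`, divided by `E`. -/
def waveMatrixDeriv (h₁ r₁ t₁ r₂ t₂ : ℝ) : Matrix (Fin 4) (Fin 4) ℝ :=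
  !![0, 0, 0, 2 * h₁ * (1 - r₁ * t₁) - (r₂ * t₁ + r₁ * t₂);
    0, 2 * h₁ * t₁ + t₂, -(2 * h₁), 0; 0, -(2 * h₁), 2 * h₁ * r₁ + r₂, 0;
    2 * h₁ * (1 - r₁ * t₁) - (r₂ * t₁ + r₁ * t₂), 0, 0, 0]

theorem hasDerivAt_waveMatrix {h r₁ t₁ : ℝ → ℝ} {h₁ r₂ t₂ s : ℝ} (hh : HasDerivAt h h₁ s)
    (hr : HasDerivAt r₁ r₂ s) (ht : HasDerivAt t₁ t₂ s) (i j : Fin 4) :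
    HasDerivAt (fun x => waveMatrix (Real.exp (2 * h x)) (r₁ x) (t₁ x) i j)
      (Real.exp (2 * h s) * waveMatrixDeriv h₁ (r₁ s) (t₁ s) r₂ t₂ i j) s := by
  have hE : HasDerivAt (fun x => Real.exp (2 * h x)) (Real.exp (2 * h s) * (2 * h₁)) s :=
    (hh.const_mul 2).exp
  have h0 : HasDerivAt (fun _ : ℝ => (0 : ℝ)) (Real.exp (2 * h s) * 0) s := by
    simpa using hasDerivAt_const s (0 : ℝ)
  have h1 := hE.mul ((hr.mul ht).const_sub 1)
  have h2 := hE.mul ht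
  have h3 := hE.neg
  have h4 := hE.mul hr
  fin_cases i <;> fin_cases j <;>
    first
    | exact h0
    | exact h1.congr_deriv (by simp [waveMatrixDeriv]; ring)
    | exact h2.congr_deriv (by simp [waveMatrixDeriv]; ring)
    | exact h3.congr_deriv (by simp [waveMatrixDeriv]; try ring)
    | exact h4.congr_deriv (by simp [waveMatrixDeriv]; ring)

/-- The Christoffel symbols of `solMetric` from the derivatives of `h`, `r`, `t`. -/
def solSymbol (h₁ r₁ t₁ r₂ t₂ : ℝ) : Fin 4 → Matrix (Fin 4) (Fin 4) ℝ :=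
  waveSymbol (2 * h₁ - (r₂ * t₁ + r₁ * t₂) / (1 - r₁ * t₁))
    (h₁ - r₁ * t₂ / (2 * (1 - r₁ * t₁))) (-r₂ / (2 * (1 - r₁ * t₁)))
    (-t₂ / (2 * (1 - r₁ * t₁))) (h₁ - t₁ * r₂ / (2 * (1 - r₁ * t₁)))
    (-(2 * h₁ * t₁ + t₂) / (2 * (1 - r₁ * t₁))) (h₁ / (1 - r₁ * t₁))
    (-(2 * h₁ * r₁ + r₂) / (2 * (1 - r₁ * t₁)))

theorem christoffel_solMetric {r t h : ℝ → ℝ} {m : Fin 4 → ℝ} {h₁ r₂ t₂ : ℝ}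
    (hh : HasDerivAt h h₁ (m 3)) (hr : HasDerivAt (deriv r) r₂ (m 3))
    (ht : HasDerivAt (deriv t) t₂ (m 3)) (hD : 1 - deriv r (m 3) * deriv t (m 3) ≠ 0)
    (k i j : Fin 4) :
    christoffel (solMetric r t h) k i j m =
      solSymbol h₁ (deriv r (m 3)) (deriv t (m 3)) r₂ t₂ k i j := by
  have hpd : ∀ i j l, pd i (fun x => solMetric r t h x j l) m = if i = 3 then
      Real.exp (2 * h (m 3)) * waveMatrixDeriv h₁ (deriv r (m 3)) (deriv t (m 3)) r₂ t₂ j l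
      else 0 := by
    intro i j l
    simp only [solMetric_eq]
    exact pd_comp_last (hasDerivAt_waveMatrix hh hr ht j l) i
  have hE : Real.exp (2 * h (m 3)) ≠ 0 := (Real.exp_pos _).ne'
  simp only [christoffel, hpd]
  rw [solMetric_eq, waveMatrix_inv hE hD]
  generalize Real.exp (2 * h (m 3)) = E at *
  generalize deriv r (m 3) = r₁ at *
  generalize deriv t (m 3) = t₁ at *
  clear hpd hh hr ht
  fin_cases k <;> fin_cases i <;> fin_cases j <;>
    simp [solSymbol, waveSymbol, waveMatrixDeriv, Fin.sum_univ_four] <;> field_simp <;> ring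

/-! ### Signature from the determinant and a null vector -/

/-- Spectral theorem, with each orthonormal eigenvector rescaled by `|λ|^{-1/2}`. -/
theorem exists_congr_diagonal_signs {n : ℕ} {M : Matrix (Fin n) (Fin n) ℝ} (hM : M.IsSymm)
    (hdet : M.det ≠ 0) :
    ∃ (P : Matrix (Fin n) (Fin n) ℝ) (ε : Fin n → ℝ), IsUnit P.det ∧
      (∀ i, ε i = 1 ∨ ε i = -1) ∧ P.transpose * M * P = Matrix.diagonal ε := by
  have hH : M.IsHermitian := by
    rw [Matrix.IsHermitian, Matrix.conjTranspose_eq_transpose_of_trivial]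
    exact hM
  have hne : ∀ i, hH.eigenvalues i ≠ 0 := by
    rw [hH.det_eq_prod_eigenvalues] at hdet
    intro i hi
    exact hdet (Finset.prod_eq_zero (Finset.mem_univ i) (by simp [hi]))
  set U : Matrix (Fin n) (Fin n) ℝ := (hH.eigenvectorUnitary : Matrix (Fin n) (Fin n) ℝ) with hU
  have hdiag : U.transpose * M * U = Matrix.diagonal hH.eigenvalues := by
    have := hH.conjStarAlgAut_star_eigenvectorUnitary
    simpa [Unitary.conjStarAlgAut_apply, Matrix.star_eq_conjTranspose, hU,
      Matrix.conjTranspose_eq_transpose_of_trivial, Function.comp_def] using this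
  have hUU : U.transpose * U = 1 := by
    have := Unitary.coe_star_mul_self hH.eigenvectorUnitary
    simpa [Matrix.star_eq_conjTranspose, Matrix.conjTranspose_eq_transpose_of_trivial] using this
  set d : Fin n → ℝ := fun i => (Real.sqrt |hH.eigenvalues i|)⁻¹ with hd
  have hpos : ∀ i, 0 < Real.sqrt |hH.eigenvalues i| := fun i =>
    Real.sqrt_pos.mpr (abs_pos.mpr (hne i))
  refine ⟨U * Matrix.diagonal d, fun i => hH.eigenvalues i / |hH.eigenvalues i|, ?_, ?_, ?_⟩
  · have h1 : IsUnit U.det := by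
      have := congrArg Matrix.det hUU
      rw [Matrix.det_mul, Matrix.det_one] at this
      exact IsUnit.of_mul_eq_one_right _ this
    rw [Matrix.det_mul, Matrix.det_diagonal]
    exact h1.mul (IsUnit.mk0 _ (Finset.prod_ne_zero_iff.mpr fun i _ => (inv_pos.mpr (hpos i)).ne'))
  · intro i
    beta_reduce
    rcases lt_or_gt_of_ne (hne i) with h | h
    · right; rw [abs_of_neg h, div_neg, div_self (hne i)]
    · left; rw [abs_of_pos h, div_self (hne i)]
  · rw [Matrix.transpose_mul, Matrix.diagonal_transpose]
    calc Matrix.diagonal d * U.transpose * M * (U * Matrix.diagonal d)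
        = Matrix.diagonal d * (U.transpose * M * U) * Matrix.diagonal d := by
          simp only [Matrix.mul_assoc]
      _ = _ := by
          rw [hdiag, Matrix.diagonal_mul_diagonal, Matrix.diagonal_mul_diagonal]
          congr 1
          ext i
          have := Real.mul_self_sqrt (abs_nonneg (hH.eigenvalues i))
          have h2 := (hpos i).ne'
          have h3 := abs_ne_zero.mpr (hne i)
          simp only [hd]
          field_simp
          rw [sq, this, mul_comm]

/-- Taking determinants in `Pᵀ M P = diag ε` gives `(det P)² det M = (-1)^b`. -/
theorem HasSignature.det_sign {n a b : ℕ} {M : Matrix (Fin n) (Fin n) ℝ} (h : HasSignature M a b) :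
    0 < (-1) ^ b * M.det := by
  obtain ⟨P, ε, hP, hε, -, hb, hPM⟩ := h
  have hd := congrArg Matrix.det hPM
  rw [Matrix.det_mul, Matrix.det_mul, Matrix.det_transpose, Matrix.det_diagonal] at hd
  have hprod : ∏ i, ε i = (-1) ^ b := by
    classical
    have h1 : ∀ i, ε i = if i ∈ Finset.univ.filter (fun i => ε i = -1) then -1 else 1 := by
      intro i
      rcases hε i with h | h <;> simp [h]
    rw [Finset.prod_congr rfl fun i _ => h1 i, Finset.prod_ite_mem, Finset.univ_inter,
      Finset.prod_const, ← hb, ← Set.ncard_coe_finset]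
    simp
  have hP0 : 0 < P.det ^ 2 := by
    have := hP.ne_zero
    positivity
  have h2 : ((-1 : ℝ) ^ b) ^ 2 = 1 := by rw [← pow_mul, mul_comm, pow_mul]; norm_num
  have h3 : P.det ^ 2 * ((-1) ^ b * M.det) = 1 := by
    have : P.det * M.det * P.det = (-1) ^ b := hd.trans hprod
    linear_combination (-1) ^ b * this + h2
  by_contra hcon
  nlinarith [mul_nonneg hP0.le (not_lt.mp hcon |> neg_nonneg.mpr)]

/-- A nonzero null vector rules out definiteness, and in dimension four the remaining sign counts
are `(2,2)`, `(3,1)` and `(1,3)`. -/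
theorem isSplit_or_isLorentzian {M : Matrix (Fin 4) (Fin 4) ℝ} (hM : M.IsSymm)
    (hdet : M.det ≠ 0) {v : Fin 4 → ℝ} (hv : v ≠ 0) (hnull : v ⬝ᵥ M.mulVec v = 0) :
    IsSplit M ∨ IsLorentzian M := by
  obtain ⟨P, ε, hP, hε, hPM⟩ := exists_congr_diagonal_signs hM hdet
  have hsum : ∑ i, ε i * (P⁻¹.mulVec v) i ^ 2 = 0 := by
    have h1 : v = P.mulVec (P⁻¹.mulVec v) := by
      rw [Matrix.mulVec_mulVec, Matrix.mul_nonsing_inv _ hP, Matrix.one_mulVec]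
    set w := P⁻¹.mulVec v
    have h2 : w ⬝ᵥ (Matrix.diagonal ε).mulVec w = 0 := by
      rw [← hPM, ← hnull, h1, ← Matrix.mulVec_mulVec, ← Matrix.mulVec_mulVec,
        Matrix.dotProduct_mulVec, Matrix.vecMul_transpose]
    rw [← h2, dotProduct]
    exact Finset.sum_congr rfl fun i _ => by rw [Matrix.mulVec_diagonal]; ring
  have hw : P⁻¹.mulVec v ≠ 0 := by
    intro h
    apply hv
    rw [← Matrix.one_mulVec v, ← Matrix.mul_nonsing_inv _ hP, ← Matrix.mulVec_mulVec, h,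
      Matrix.mulVec_zero]
  have hpos : 0 < ∑ i, (P⁻¹.mulVec v) i ^ 2 := by
    obtain ⟨i, hi⟩ := Function.ne_iff.mp hw
    exact Finset.sum_pos' (fun i _ => sq_nonneg _) ⟨i, Finset.mem_univ _, by
      have : (P⁻¹.mulVec v) i ≠ 0 := hi
      positivity⟩
  simp only [Fin.sum_univ_four] at hsum hpos
  have key : ∀ a b : ℕ, Set.ncard {i | ε i = 1} = a → Set.ncard {i | ε i = -1} = b →
      HasSignature M a b := fun a b ha hb => ⟨P, ε, hP, hε, ha, hb, hPM⟩
  have e1 : {i | ε i = 1} = (Finset.univ.filter fun i => ε i = 1 : Finset (Fin 4)) := by simp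
  have e2 : {i | ε i = -1} = (Finset.univ.filter fun i => ε i = -1 : Finset (Fin 4)) := by simp
  simp only [e1, e2, Set.ncard_coe_finset, Finset.card_filter, Fin.sum_univ_four] at key
  unfold IsLorentzian IsSplit
  have hn : (-1 : ℝ) ≠ 1 := by norm_num
  -- In the two definite patterns among the sixteen, `hsum` says that plus or minus the sum of
  -- squares in `hpos` is zero; these go to `linarith`.
  rcases hε 0 with h0 | h0 <;> rcases hε 1 with h1 | h1 <;> rcases hε 2 with h2 | h2 <;>
    rcases hε 3 with h3 | h3 <;> simp only [h0, h1, h2, h3, hn, hn.symm, if_true, if_false] at key hsum <;>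
    first
    | exact Or.inl (key 2 2 rfl rfl)
    | exact Or.inr (Or.inl (key 3 1 rfl rfl))
    | exact Or.inr (Or.inr (key 1 3 rfl rfl))
    | linarith

theorem isSplit_isLorentzian_iff_det_sign {M : Matrix (Fin 4) (Fin 4) ℝ} (hM : M.IsSymm)
    (hdet : M.det ≠ 0) {v : Fin 4 → ℝ} (hv : v ≠ 0) (hnull : v ⬝ᵥ M.mulVec v = 0) :
    (IsSplit M ↔ 0 < M.det) ∧ (IsLorentzian M ↔ M.det < 0) := by
  have h1 : IsSplit M → 0 < M.det := fun h => by simpa using HasSignature.det_sign h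
  have h2 : IsLorentzian M → M.det < 0 := by
    rintro (h | h) <;> have := HasSignature.det_sign h <;> norm_num at this <;> exact this
  rcases isSplit_or_isLorentzian hM hdet hv hnull with h | h
  · exact ⟨⟨h1, fun _ => h⟩, ⟨h2, fun h' => absurd (h1 h) h'.not_gt⟩⟩
  · exact ⟨⟨h1, fun h' => absurd (h2 h) h'.not_gt⟩, ⟨h2, fun _ => h⟩⟩

/-! ### Ricci curvature and flatness -/

theorem riemann_eq_symbolCurvature {g : (Fin 4 → ℝ) → Matrix (Fin 4) (Fin 4) ℝ}
    {U : Set (Fin 4 → ℝ)} (hU : IsOpen U) {m : Fin 4 → ℝ} (hm : m ∈ U)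
    {Γ : ℝ → Fin 4 → Matrix (Fin 4) (Fin 4) ℝ} {Γ' : Fin 4 → Matrix (Fin 4) (Fin 4) ℝ}
    (hΓ : ∀ x ∈ U, ∀ l i j, christoffel g l i j x = Γ (x 3) l i j)
    (hΓ' : ∀ l i j, HasDerivAt (fun s => Γ s l i j) (Γ' l i j) (m 3)) (l k i j : Fin 4) :
    riemann g l k i j m = symbolCurvature (Γ (m 3)) Γ' l k i j := by
  have hpd : ∀ i l j k, pd i (christoffel g l j k) m = if i = 3 then Γ' l j k else 0 := by
    intro i l j k
    rw [← pd_comp_last (hΓ' l j k) i]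
    exact pd_congr (Filter.eventually_of_mem (hU.mem_nhds hm) fun x hx => hΓ x hx l j k)
  simp only [riemann, symbolCurvature, hpd, hΓ m hm]

/-- The derivative of `solSymbol` along `s`. -/
def solSymbolDeriv (h₁ r₁ t₁ h₂ r₂ t₂ r₃ t₃ : ℝ) : Fin 4 → Matrix (Fin 4) (Fin 4) ℝ :=
  waveSymbol (2 * h₂ - ((r₃ * t₁ + 2 * (r₂ * t₂) + r₁ * t₃) / (1 - r₁ * t₁)
      + (r₂ * t₁ + r₁ * t₂) ^ 2 / (1 - r₁ * t₁) ^ 2))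
    (h₂ - ((r₂ * t₂ + r₁ * t₃) / (2 * (1 - r₁ * t₁))
      + r₁ * t₂ * (r₂ * t₁ + r₁ * t₂) / (2 * (1 - r₁ * t₁) ^ 2)))
    (-r₃ / (2 * (1 - r₁ * t₁)) - r₂ * (r₂ * t₁ + r₁ * t₂) / (2 * (1 - r₁ * t₁) ^ 2))
    (-t₃ / (2 * (1 - r₁ * t₁)) - t₂ * (r₂ * t₁ + r₁ * t₂) / (2 * (1 - r₁ * t₁) ^ 2))
    (h₂ - ((t₂ * r₂ + t₁ * r₃) / (2 * (1 - r₁ * t₁))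
      + t₁ * r₂ * (r₂ * t₁ + r₁ * t₂) / (2 * (1 - r₁ * t₁) ^ 2)))
    (-(2 * h₂ * t₁ + 2 * h₁ * t₂ + t₃) / (2 * (1 - r₁ * t₁))
      - (2 * h₁ * t₁ + t₂) * (r₂ * t₁ + r₁ * t₂) / (2 * (1 - r₁ * t₁) ^ 2))
    (h₂ / (1 - r₁ * t₁) + h₁ * (r₂ * t₁ + r₁ * t₂) / (1 - r₁ * t₁) ^ 2)
    (-(2 * h₂ * r₁ + 2 * h₁ * r₂ + r₃) / (2 * (1 - r₁ * t₁))
      - (2 * h₁ * r₁ + r₂) * (r₂ * t₁ + r₁ * t₂) / (2 * (1 - r₁ * t₁) ^ 2))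

theorem hasDerivAt_solSymbol {h₁ r₁ t₁ r₂ t₂ : ℝ → ℝ} {h₂ r₃ t₃ s : ℝ} (hh : HasDerivAt h₁ h₂ s)
    (hr : HasDerivAt r₁ (r₂ s) s) (ht : HasDerivAt t₁ (t₂ s) s) (hr' : HasDerivAt r₂ r₃ s)
    (ht' : HasDerivAt t₂ t₃ s) (hD : 1 - r₁ s * t₁ s ≠ 0) (l i j : Fin 4) :
    HasDerivAt (fun x => solSymbol (h₁ x) (r₁ x) (t₁ x) (r₂ x) (t₂ x) l i j)
      (solSymbolDeriv (h₁ s) (r₁ s) (t₁ s) h₂ (r₂ s) (t₂ s) r₃ t₃ l i j) s := by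
  have hd : HasDerivAt (fun x => 1 - r₁ x * t₁ x) (-(r₂ s * t₁ s + r₁ s * t₂ s)) s :=
    (hr.mul ht).const_sub 1
  have hd2 := hd.const_mul 2
  have hD2 : 2 * (1 - r₁ s * t₁ s) ≠ 0 := mul_ne_zero two_ne_zero hD
  refine hasDerivAt_waveSymbol ?_ ?_ ?_ ?_ ?_ ?_ ?_ ?_ l i j
  · exact ((hh.const_mul 2).sub (((hr'.mul ht).add (hr.mul ht')).div hd hD)).congr_deriv
      (by simp only [Pi.add_apply, Pi.mul_apply]; field_simp; ring)
  · exact (hh.sub ((hr.mul ht').div hd2 hD2)).congr_deriv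
      (by simp only [Pi.mul_apply]; field_simp; ring)
  · exact (hr'.neg.div hd2 hD2).congr_deriv (by simp only [Pi.neg_apply]; field_simp)
  · exact (ht'.neg.div hd2 hD2).congr_deriv (by simp only [Pi.neg_apply]; field_simp)
  · exact (hh.sub ((ht.mul hr').div hd2 hD2)).congr_deriv
      (by simp only [Pi.mul_apply]; field_simp; ring)
  · exact ((((hh.const_mul 2).mul ht).add ht').neg.div hd2 hD2).congr_deriv
      (by simp only [Pi.add_apply, Pi.neg_apply, Pi.mul_apply]; field_simp)
  · exact (hh.div hd hD).congr_deriv (by field_simp; ring)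
  · exact ((((hh.const_mul 2).mul hr).add hr').neg.div hd2 hD2).congr_deriv
      (by simp only [Pi.add_apply, Pi.neg_apply, Pi.mul_apply]; field_simp)

theorem hasDerivAt_deriv_of_contDiffOn {f : ℝ → ℝ} {J : Set ℝ} (hJ : IsOpen J)
    (hf : ContDiffOn ℝ 2 f J) {s : ℝ} (hs : s ∈ J) :
    HasDerivAt f (deriv f s) s ∧ HasDerivAt (deriv f) (iteratedDeriv 2 f s) s := by
  refine ⟨((hf.differentiableOn (by norm_num)).differentiableAt (hJ.mem_nhds hs)).hasDerivAt, ?_⟩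
  rw [iteratedDeriv_succ, iteratedDeriv_one]
  exact (((hf.deriv_of_isOpen (m := 1) hJ (by norm_num)).differentiableOn
    (by norm_num)).differentiableAt (hJ.mem_nhds hs)).hasDerivAt

theorem hasDerivAt_iteratedDeriv_two {f : ℝ → ℝ} {J : Set ℝ} (hJ : IsOpen J)
    (hf : ContDiffOn ℝ 3 f J) {s : ℝ} (hs : s ∈ J) :
    HasDerivAt (deriv f) (iteratedDeriv 2 f s) s ∧
      HasDerivAt (iteratedDeriv 2 f) (iteratedDeriv 3 f s) s := by
  have h2 := hasDerivAt_deriv_of_contDiffOn hJ (hf.deriv_of_isOpen (m := 2) hJ (by norm_num)) hs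
  have e2 : iteratedDeriv 2 f = deriv (deriv f) := by rw [iteratedDeriv_succ, iteratedDeriv_one]
  rw [iteratedDeriv_succ (n := 2), e2]
  rw [iteratedDeriv_succ, iteratedDeriv_one] at h2
  exact h2

section Curvature

variable {J : Set ℝ} {r t h : ℝ → ℝ}

/-- The Christoffel symbols of `solMetric r t h` over `s`. -/
def solSymbolAt (r t h : ℝ → ℝ) (s : ℝ) : Fin 4 → Matrix (Fin 4) (Fin 4) ℝ :=
  solSymbol (deriv h s) (deriv r s) (deriv t s) (iteratedDeriv 2 r s) (iteratedDeriv 2 t s)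

/-- The derivative of `solSymbolAt`. -/
def solSymbolDerivAt (r t h : ℝ → ℝ) (s : ℝ) : Fin 4 → Matrix (Fin 4) (Fin 4) ℝ :=
  solSymbolDeriv (deriv h s) (deriv r s) (deriv t s) (iteratedDeriv 2 h s) (iteratedDeriv 2 r s)
    (iteratedDeriv 2 t s) (iteratedDeriv 3 r s) (iteratedDeriv 3 t s)

theorem christoffel_solMetric_eq (hJ : IsOpen J) (hr : ContDiffOn ℝ 3 r J)
    (ht : ContDiffOn ℝ 3 t J) (hD : ∀ s ∈ J, 1 - deriv r s * deriv t s ≠ 0)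
    (hh : ContDiffOn ℝ 2 h J) {m : Fin 4 → ℝ} (hm : m ∈ solDomain J) (k i j : Fin 4) :
    christoffel (solMetric r t h) k i j m = solSymbolAt r t h (m 3) k i j :=
  christoffel_solMetric (hasDerivAt_deriv_of_contDiffOn hJ hh hm).1
    (hasDerivAt_iteratedDeriv_two hJ hr hm).1 (hasDerivAt_iteratedDeriv_two hJ ht hm).1 (hD _ hm)
    k i j

theorem hasDerivAt_solSymbolAt (hJ : IsOpen J) (hr : ContDiffOn ℝ 3 r J)
    (ht : ContDiffOn ℝ 3 t J) (hD : ∀ s ∈ J, 1 - deriv r s * deriv t s ≠ 0)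
    (hh : ContDiffOn ℝ 2 h J) {s : ℝ} (hs : s ∈ J) (l i j : Fin 4) :
    HasDerivAt (fun s => solSymbolAt r t h s l i j) (solSymbolDerivAt r t h s l i j) s :=
  hasDerivAt_solSymbol (hasDerivAt_deriv_of_contDiffOn hJ hh hs).2
    (hasDerivAt_iteratedDeriv_two hJ hr hs).1 (hasDerivAt_iteratedDeriv_two hJ ht hs).1
    (hasDerivAt_iteratedDeriv_two hJ hr hs).2 (hasDerivAt_iteratedDeriv_two hJ ht hs).2 (hD _ hs)
    l i j

theorem riemann_solMetric (hJ : IsOpen J) (hr : ContDiffOn ℝ 3 r J)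
    (ht : ContDiffOn ℝ 3 t J) (hD : ∀ s ∈ J, 1 - deriv r s * deriv t s ≠ 0)
    (hh : ContDiffOn ℝ 2 h J) {m : Fin 4 → ℝ} (hm : m ∈ solDomain J) (l k i j : Fin 4) :
    riemann (solMetric r t h) l k i j m =
      symbolCurvature (solSymbolAt r t h (m 3)) (solSymbolDerivAt r t h (m 3)) l k i j :=
  riemann_eq_symbolCurvature (isOpen_solDomain hJ) hm
    (fun _ hx => christoffel_solMetric_eq hJ hr ht hD hh hx)
    (hasDerivAt_solSymbolAt hJ hr ht hD hh hm) l k i j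

theorem deriv_mul_deriv (hJ : IsOpen J) (hr : ContDiffOn ℝ 3 r J)
    (ht : ContDiffOn ℝ 3 t J) {s : ℝ} (hs : s ∈ J) :
    deriv (fun x => deriv r x * deriv t x) s =
      iteratedDeriv 2 r s * deriv t s + deriv r s * iteratedDeriv 2 t s :=
  ((hasDerivAt_iteratedDeriv_two hJ hr hs).1.mul (hasDerivAt_iteratedDeriv_two hJ ht hs).1).deriv

theorem ricciFlatOn_solMetric_iff (hJ : IsOpen J) (hr : ContDiffOn ℝ 3 r J)
    (ht : ContDiffOn ℝ 3 t J) (hD : ∀ s ∈ J, 1 - deriv r s * deriv t s ≠ 0)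
    (hh : ContDiffOn ℝ 2 h J) :
    RicciFlatOn (solMetric r t h) (solDomain J) ↔ ∀ s ∈ J, RicciODE r t h s := by
  have key : ∀ m ∈ solDomain J, (∀ k j, ricci (solMetric r t h) k j m = 0) ↔
      RicciODE r t h (m 3) := by
    intro m hm
    have hDm := hD _ hm
    have hric : ∀ k j, ricci (solMetric r t h) k j m = _ := fun k j =>
      (Finset.sum_congr rfl fun i _ => riemann_solMetric hJ hr ht hD hh hm i k i j).trans
        (sum_symbolCurvature_waveSymbol _ _ _ _ _ _ _ _ _ _ _ _ _ _ _ _ k j)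
    simp only [hric]
    rw [RicciODE, deriv_mul_deriv hJ ht hr hm]
    generalize deriv r (m 3) = r₁ at *
    generalize deriv t (m 3) = t₁ at *
    generalize deriv h (m 3) = h₁ at *
    generalize iteratedDeriv 2 r (m 3) = r₂ at *
    generalize iteratedDeriv 2 t (m 3) = t₂ at *
    generalize iteratedDeriv 2 h (m 3) = h₂ at *
    generalize iteratedDeriv 3 r (m 3) = r₃ at *
    generalize iteratedDeriv 3 t (m 3) = t₃ at *
    clear hric
    rw [← sub_eq_zero (a := h₂)]
    -- Here `a` is the `ss` Ricci component and `b` the difference of the two sides of the ODE; the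
    -- factor `-2` comes from the `2h''` in `tr K'`.
    have e : ∀ a b : ℝ, a = -2 * b → ((∀ k j : Fin 4, (if k = 3 ∧ j = 3 then a else 0) = 0) ↔
        b = 0) := by
      intro a b hab
      constructor
      · intro H
        have := H 3 3
        simp only [and_self, if_true] at this
        linarith
      · intro H k j
        rw [hab, H]; simp
    apply e
    generalize hd : 1 - r₁ * t₁ = D at *
    field_simp
    rw [← hd]
    ring
  constructor
  · intro H s hs
    have hm : Pi.single 3 s ∈ solDomain J := by simpa [solDomain] using hs
    simpa using (key _ hm).mp (H _ hm)
  · intro H m hm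
    exact (key m hm).mpr (H _ hm)

theorem flatOn_solMetric (hJ : IsOpen J) (hr : ContDiffOn ℝ 3 r J)
    (ht : ContDiffOn ℝ 3 t J) (hD : ∀ s ∈ J, 1 - deriv r s * deriv t s ≠ 0)
    (hh : ContDiffOn ℝ 2 h J) (hric : ∀ s ∈ J, RicciODE r t h s)
    (hflat : ∀ s ∈ J, FlatnessODEs r t s) : FlatOn (solMetric r t h) (solDomain J) := by
  intro m hm l k i j
  have hDm := hD _ hm
  have h1 := hric _ hm
  obtain ⟨h2, h3⟩ := hflat _ hm
  rw [RicciODE, deriv_mul_deriv hJ ht hr hm] at h1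
  rw [deriv_mul_deriv hJ hr ht hm] at h2 h3
  rw [riemann_solMetric hJ hr ht hD hh hm, solSymbolAt, solSymbolDerivAt]
  generalize deriv r (m 3) = r₁ at *
  generalize deriv t (m 3) = t₁ at *
  generalize deriv h (m 3) = h₁ at *
  generalize iteratedDeriv 2 r (m 3) = r₂ at *
  generalize iteratedDeriv 2 t (m 3) = t₂ at *
  generalize iteratedDeriv 2 h (m 3) = h₂ at *
  generalize iteratedDeriv 3 r (m 3) = r₃ at *
  generalize iteratedDeriv 3 t (m 3) = t₃ at *
  -- Eliminating the third derivatives of `r` and `t` collapses the inhomogeneous term of the Ricci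
  -- ODE to `r''t''/(4D)`.
  have h4 : h₂ = h₁ ^ 2 - h₁ * (r₂ * t₁ + r₁ * t₂) / (1 - r₁ * t₁)
      + r₂ * t₂ / (4 * (1 - r₁ * t₁)) := by
    rw [h1, h2, h3]
    generalize hd : 1 - r₁ * t₁ = D at *
    field_simp
    rw [← hd]
    ring
  rw [h2, h3, h4, solSymbol, solSymbolDeriv]
  clear h1 h2 h3 h4
  generalize hd : 1 - r₁ * t₁ = D at *
  apply symbolCurvature_waveSymbol_eq_zero <;> field_simp <;> rw [← hd] <;> ring

end Curvature

/-! ### Conformal change and necessity of the flatness ODEs -/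

theorem pd_exp_mul {n : ℕ} {f φ : (Fin n → ℝ) → ℝ} {m : Fin n → ℝ} (hf : DifferentiableAt ℝ f m)
    (hφ : DifferentiableAt ℝ φ m) (i : Fin n) :
    pd i (fun x => Real.exp (2 * f x) * φ x) m =
      Real.exp (2 * f m) * (2 * pd i f m * φ m + pd i φ m) := by
  have h : HasFDerivAt (fun x => Real.exp (2 * f x) * φ x) _ m :=
    ((hf.hasFDerivAt.const_mul 2).exp).mul hφ.hasFDerivAt
  rw [pd, h.fderiv, pd, pd]
  simp
  ring

/-- The classical rule: the connection changes by `δ^k_j ∂_i f + δ^k_i ∂_j f - g_ij ∇^k f`. -/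
theorem christoffel_exp_smul {n : ℕ} {g : (Fin n → ℝ) → Matrix (Fin n) (Fin n) ℝ}
    {f : (Fin n → ℝ) → ℝ} {m : Fin n → ℝ} (hf : DifferentiableAt ℝ f m)
    (hg : ∀ i j, DifferentiableAt ℝ (fun x => g x i j) m) (hsymm : (g m).IsSymm)
    (hdet : (g m).det ≠ 0) (k i j : Fin n) :
    christoffel (fun x => Real.exp (2 * f x) • g x) k i j m =
      christoffel g k i j m + (if k = j then pd i f m else 0) + (if k = i then pd j f m else 0)
        - g m i j * ∑ l, (g m)⁻¹ k l * pd l f m := by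
  have hE : Real.exp (2 * f m) ≠ 0 := (Real.exp_pos _).ne'
  have hinv : (Real.exp (2 * f m) • g m)⁻¹ = (Real.exp (2 * f m))⁻¹ • (g m)⁻¹ := by
    have := Matrix.inv_smul' (A := g m) (Units.mk0 _ hE) (isUnit_iff_ne_zero.mpr hdet)
    simpa [Units.smul_def] using this
  have hδ : ∀ i, ∑ l, (g m)⁻¹ k l * g m i l = if k = i then 1 else 0 := by
    intro i
    rw [← Matrix.one_apply, ← Matrix.nonsing_inv_mul (g m) (isUnit_iff_ne_zero.mpr hdet),
      Matrix.mul_apply]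
    exact Finset.sum_congr rfl fun l _ => by rw [hsymm.apply]
  simp only [christoffel, Matrix.smul_apply, smul_eq_mul, hinv, pd_exp_mul hf (hg _ _)]
  have hj : (if k = j then pd i f m else 0) = ∑ l, (g m)⁻¹ k l * g m j l * pd i f m := by
    rw [← Finset.sum_mul, hδ]; simp
  have hi : (if k = i then pd j f m else 0) = ∑ l, (g m)⁻¹ k l * g m i l * pd j f m := by
    rw [← Finset.sum_mul, hδ]; simp
  rw [hi, hj]
  simp only [Finset.mul_sum, ← Finset.sum_add_distrib, ← Finset.sum_sub_distrib]
  refine Finset.sum_congr rfl fun l _ => ?_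
  field_simp
  ring

theorem isMetricOn_solMetric {r t h : ℝ → ℝ} {J : Set ℝ} (hJ : IsOpen J)
    (hr : ContDiffOn ℝ 3 r J) (ht : ContDiffOn ℝ 3 t J)
    (hD : ∀ s ∈ J, 1 - deriv r s * deriv t s ≠ 0) (hh : ContDiffOn ℝ 2 h J) :
    IsMetricOn (solMetric r t h) (solDomain J) := by
  have hr' := hr.deriv_of_isOpen (m := 2) hJ (by norm_num)
  have ht' := ht.deriv_of_isOpen (m := 2) hJ (by norm_num)
  have hE : ContDiffOn ℝ 2 (fun s => Real.exp (2 * h s)) J := (contDiffOn_const.mul hh).exp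
  have hd := hE.mul (contDiffOn_const (c := (1 : ℝ)).sub (hr'.mul ht'))
  have hs : ∀ i j, ContDiffOn ℝ 2
      (fun s => waveMatrix (Real.exp (2 * h s)) (deriv r s) (deriv t s) i j) J := by
    intro i j
    fin_cases i <;> fin_cases j <;>
      first
      | exact contDiffOn_const
      | exact hd
      | exact hE.mul ht'
      | exact hE.neg
      | exact hE.mul hr'
  refine ⟨fun i j => ?_, fun m hm => ?_⟩
  · simp only [solMetric_eq]
    exact (hs i j).comp (contDiff_apply ℝ ℝ (3 : Fin 4)).contDiffOn fun m hm => hm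
  · rw [solMetric_eq, det_waveMatrix]
    exact ⟨waveMatrix_isSymm _ _ _,
      mul_ne_zero (pow_ne_zero _ (Real.exp_pos _).ne') (pow_ne_zero _ (hD _ hm))⟩

/-- Two curvature components are independent of `f`, even though `f` may depend on all coordinates.
The symbols differentiated in them have no conformal correction, because `g_ps = g_qs = g_ss = 0`,
so first derivatives of `f` suffice; in the quadratic terms `∂_s f` cancels. -/
theorem flatnessODEs_of_flatOn {r t h : ℝ → ℝ} {J : Set ℝ} (hJ : IsOpen J)
    (hr : ContDiffOn ℝ 3 r J) (ht : ContDiffOn ℝ 3 t J)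
    (hD : ∀ s ∈ J, 1 - deriv r s * deriv t s ≠ 0) (hh : ContDiffOn ℝ 2 h J)
    {V : Set (Fin 4 → ℝ)} (hV : IsOpen V) (hVJ : V ⊆ solDomain J) {f : (Fin 4 → ℝ) → ℝ}
    (hf : DifferentiableOn ℝ f V)
    (hflat : FlatOn (fun x => Real.exp (2 * f x) • solMetric r t h x) V) {m : Fin 4 → ℝ}
    (hm : m ∈ V) : FlatnessODEs r t (m 3) := by
  have hmet := isMetricOn_solMetric hJ hr ht hD hh
  have hΓ : ∀ x ∈ V, ∀ k i j, christoffel (fun x => Real.exp (2 * f x) • solMetric r t h x) k i j x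
      = solSymbolAt r t h (x 3) k i j + (if k = j then pd i f x else 0)
        + (if k = i then pd j f x else 0)
        - solMetric r t h x i j * ∑ l, (solMetric r t h x)⁻¹ k l * pd l f x := by
    intro x hx k i j
    rw [christoffel_exp_smul (hf.differentiableAt (hV.mem_nhds hx))
      (fun i j => ((hmet.1 i j).differentiableOn (by norm_num)).differentiableAt
        ((isOpen_solDomain hJ).mem_nhds (hVJ hx))) (hmet.2 x (hVJ hx)).1 (hmet.2 x (hVJ hx)).2,
      christoffel_solMetric_eq hJ hr ht hD hh (hVJ hx)]
  have h23 : ∀ x, solMetric r t h x 2 3 = 0 ∧ solMetric r t h x 1 3 = 0 ∧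
      solMetric r t h x 3 1 = 0 ∧ solMetric r t h x 3 2 = 0 ∧ solMetric r t h x 3 3 = 0 := by
    intro x
    simp [solMetric_eq, waveMatrix]
  have hpd : ∀ l k i j, (∀ x ∈ V, christoffel (fun x => Real.exp (2 * f x) • solMetric r t h x)
      l j k x = solSymbolAt r t h (x 3) l j k) →
      pd i (christoffel (fun x => Real.exp (2 * f x) • solMetric r t h x) l j k) m =
        if i = 3 then solSymbolDerivAt r t h (m 3) l j k else 0 := by
    intro l k i j H
    rw [← pd_comp_last (hasDerivAt_solSymbolAt hJ hr ht hD hh (hVJ hm) l j k) i]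
    exact pd_congr (Filter.eventually_of_mem (hV.mem_nhds hm) H)
  -- These are the `p`-component of `R(∂_q, ∂_s)∂_s` and the `q`-component of `R(∂_p, ∂_s)∂_s`, that
  -- is, the off-diagonal entries of `κK - K' - K²`.
  have h1 := hflat m hm 1 3 2 3
  have h2 := hflat m hm 2 3 1 3
  rw [riemann, hpd, hpd] at h1 h2
  rotate_left
  · intro x hx; rw [hΓ x hx]; simp [h23]
  · intro x hx; rw [hΓ x hx]; simp [h23]
  · intro x hx; rw [hΓ x hx]; simp [h23]
  · intro x hx; rw [hΓ x hx]; simp [h23]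
  have hDm := hD _ (hVJ hm)
  simp [hΓ m hm, h23, Fin.sum_univ_four, solSymbolAt, solSymbolDerivAt, solSymbol, solSymbolDeriv,
    waveSymbol] at h1 h2
  rw [FlatnessODEs, deriv_mul_deriv hJ hr ht (hVJ hm)]
  generalize deriv r (m 3) = r₁ at *
  generalize deriv t (m 3) = t₁ at *
  generalize deriv h (m 3) = h₁ at *
  generalize iteratedDeriv 2 r (m 3) = r₂ at *
  generalize iteratedDeriv 2 t (m 3) = t₂ at *
  generalize iteratedDeriv 3 r (m 3) = r₃ at *
  generalize iteratedDeriv 3 t (m 3) = t₃ at *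
  generalize pd 3 f m = f₃ at *
  clear hΓ h23 hpd
  generalize hd : 1 - r₁ * t₁ = D at *
  constructor
  · field_simp at h1 ⊢
    linear_combination h1
  · field_simp at h2 ⊢
    linear_combination h2

/-! ### The Riccati equation: local existence and regularity -/

open Set Metric in
theorem exists_riccati_solution {P Q : ℝ → ℝ} {I : Set ℝ} (hI : IsOpen I)
    (hP : ContinuousOn P I) (hQ : ContinuousOn Q I) {s₀ : ℝ} (hs₀ : s₀ ∈ I) (b : ℝ) :
    ∃ δ > 0, ∃ w : ℝ → ℝ, Ioo (s₀ - δ) (s₀ + δ) ⊆ I ∧ w s₀ = b ∧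
      ∀ s ∈ Ioo (s₀ - δ) (s₀ + δ), HasDerivAt w (w s ^ 2 + P s * w s + Q s) s := by
  obtain ⟨ρ, hρ, hρI⟩ := nhds_basis_closedBall.mem_iff.mp (hI.mem_nhds hs₀)
  obtain ⟨A, hA⟩ := (isCompact_closedBall s₀ ρ).exists_bound_of_continuousOn (hP.mono hρI)
  obtain ⟨B, hB⟩ := (isCompact_closedBall s₀ ρ).exists_bound_of_continuousOn (hQ.mono hρI)
  have hA0 : 0 ≤ A := (norm_nonneg _).trans (hA s₀ (mem_closedBall_self hρ.le))
  have hB0 : 0 ≤ B := (norm_nonneg _).trans (hB s₀ (mem_closedBall_self hρ.le))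
  -- Picard–Lindelöf is applied on the ball of radius `1` around `b`, where `|x| ≤ R`. There `L`
  -- bounds the right-hand side, and `δ ≤ 1 / L` keeps the solution in the ball.
  set R := |b| + 1 with hR
  have hR1 : 1 ≤ R := by have := abs_nonneg b; linarith
  set L : ℝ := R ^ 2 + A * R + B with hL
  have hL1 : 1 ≤ L := by nlinarith [mul_nonneg hA0 (zero_le_one.trans hR1)]
  set δ := min ρ (1 / L) with hδ
  have hδ0 : 0 < δ := lt_min hρ (by positivity)
  have hIcc : Icc (s₀ - δ) (s₀ + δ) ⊆ closedBall s₀ ρ := by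
    rw [← Real.closedBall_eq_Icc]
    exact closedBall_subset_closedBall (min_le_left _ _)
  have hball : ∀ x ∈ closedBall b ((1 : NNReal) : ℝ), |x| ≤ R := by
    intro x hx
    rw [mem_closedBall, Real.dist_eq, NNReal.coe_one] at hx
    have := abs_add_le (x - b) b
    rw [sub_add_cancel] at this
    linarith
  have hpl : IsPicardLindelof (fun s x => x ^ 2 + P s * x + Q s) (tmin := s₀ - δ)
      (tmax := s₀ + δ) ⟨s₀, by constructor <;> linarith⟩ b 1 0 L.toNNReal
      (2 * R + A).toNNReal := by
    refine ⟨fun s hs => ?_, fun x _ => ?_, fun s hs x hx => ?_, ?_⟩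
    · refine LipschitzOnWith.of_dist_le_mul fun x hx y hy => ?_
      rw [Real.coe_toNNReal _ (by positivity), Real.dist_eq, Real.dist_eq,
        -- This factorization gives the Lipschitz constant `2R + A`.
        show x ^ 2 + P s * x + Q s - (y ^ 2 + P s * y + Q s) = (x + y + P s) * (x - y) by ring,
        abs_mul]
      refine mul_le_mul_of_nonneg_right ?_ (abs_nonneg _)
      have h1 := abs_add_le (x + y) (P s)
      have h2 := abs_add_le x y
      have h3 := hA s (hIcc hs)
      rw [Real.norm_eq_abs] at h3
      linarith [hball x hx, hball y hy]
    · exact ((continuousOn_const.add ((hP.mono (hIcc.trans hρI)).mul continuousOn_const)).add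
        (hQ.mono (hIcc.trans hρI)))
    · rw [Real.coe_toNNReal _ (by positivity), Real.norm_eq_abs]
      have h1 := abs_add_le (x ^ 2 + P s * x) (Q s)
      have h2 := abs_add_le (x ^ 2) (P s * x)
      have h3 := hA s (hIcc hs)
      have h4 := hB s (hIcc hs)
      rw [Real.norm_eq_abs] at h3 h4
      rw [abs_mul, abs_pow] at h2
      have h5 := hball x hx
      have h6 := mul_le_mul h3 h5 (abs_nonneg _) hA0
      have h7 := pow_le_pow_left₀ (abs_nonneg x) h5 2
      linarith
    · simp only [add_sub_cancel_left, sub_sub_cancel, max_self, NNReal.coe_one, NNReal.coe_zero,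
        sub_zero]
      rw [Real.coe_toNNReal _ (by positivity)]
      calc L * δ ≤ L * (1 / L) := mul_le_mul_of_nonneg_left (min_le_right _ _) (by positivity)
        _ = 1 := by field_simp
  obtain ⟨w, hw0, hw⟩ := hpl.exists_eq_forall_mem_Icc_hasDerivWithinAt₀
  exact ⟨δ, hδ0, w, (Ioo_subset_Icc_self.trans hIcc).trans hρI, hw0, fun s hs =>
    (hw s (Ioo_subset_Icc_self hs)).hasDerivAt (Icc_mem_nhds hs.1 hs.2)⟩

/-- Bootstrap: if `w` is `C^n` with `n ≤ k`, the equation makes `w'` of class `C^n`. Every finite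
order up to `k` is reached by induction, which also covers `k = ∞`. -/
theorem contDiffOn_riccati_solution {P Q w : ℝ → ℝ} {S : Set ℝ} (hS : IsOpen S) {k : ℕ∞}
    (hP : ContDiffOn ℝ k P S) (hQ : ContDiffOn ℝ k Q S)
    (hw : ∀ s ∈ S, HasDerivAt w (w s ^ 2 + P s * w s + Q s) s) : ContDiffOn ℝ (k + 1) w S := by
  have step : ∀ n : ℕ∞, n ≤ k → ContDiffOn ℝ n w S → ContDiffOn ℝ (n + 1) w S := by
    intro n hn hwn
    rw [contDiffOn_succ_iff_deriv_of_isOpen hS]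
    refine ⟨fun s hs => (hw s hs).differentiableAt.differentiableWithinAt, by simp, ?_⟩
    refine ContDiffOn.congr ?_ fun s hs => (hw s hs).deriv
    exact ((hwn.pow 2).add ((hP.of_le (by exact_mod_cast hn)).mul hwn)).add
      (hQ.of_le (by exact_mod_cast hn))
  refine step k le_rfl (contDiffOn_iff_forall_nat_le.mpr fun n hn => ?_)
  induction n with
  | zero =>
    exact contDiffOn_zero.mpr fun s hs => (hw s hs).continuousAt.continuousWithinAt
  | succ n ih =>
    have hn' : (n : ℕ∞) ≤ k := le_trans (by exact_mod_cast n.le_succ) hn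
    exact_mod_cast step n hn' (ih hn')

open Set in
theorem exists_hasDerivAt_Ioo {w : ℝ → ℝ} {s₀ δ : ℝ} (hδ : 0 < δ)
    (hw : ContinuousOn w (Ioo (s₀ - δ) (s₀ + δ))) (a : ℝ) :
    ∃ h : ℝ → ℝ, h s₀ = a ∧ ∀ s ∈ Ioo (s₀ - δ) (s₀ + δ), HasDerivAt h (w s) s := by
  refine ⟨fun s => a + ∫ τ in s₀..s, w τ, by simp, fun s hs => ?_⟩
  have hs₀ : s₀ ∈ Ioo (s₀ - δ) (s₀ + δ) := by constructor <;> linarith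
  refine (intervalIntegral.integral_hasDerivAt_right ?_ ?_ ?_).const_add a
  · exact (hw.mono (ordConnected_Ioo.uIcc_subset hs₀ hs)).intervalIntegrable
  · exact hw.stronglyMeasurableAtFilter isOpen_Ioo s hs
  · exact hw.continuousAt (isOpen_Ioo.mem_nhds hs)

/-- The linear coefficient of the Riccati equation for `h'` underlying `RicciODE`. -/
def riccatiLinear (r t : ℝ → ℝ) (s : ℝ) : ℝ :=
  -((iteratedDeriv 2 t s * deriv r s + deriv t s * iteratedDeriv 2 r s)
    / (1 - deriv r s * deriv t s))

/-- The inhomogeneity of the Riccati equation for `h'` underlying `RicciODE`. -/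
def riccatiConst (r t : ℝ → ℝ) (s : ℝ) : ℝ :=
  (2 * (iteratedDeriv 3 r s * deriv t s + iteratedDeriv 3 t s * deriv r s)
        * (1 - deriv r s * deriv t s)
      + 2 * iteratedDeriv 2 r s * iteratedDeriv 2 t s
      + 4 * deriv r s * deriv t s * iteratedDeriv 2 r s * iteratedDeriv 2 t s
      + 3 * deriv t s ^ 2 * iteratedDeriv 2 r s ^ 2
      + 3 * deriv r s ^ 2 * iteratedDeriv 2 t s ^ 2)
    / (8 * (1 - deriv r s * deriv t s) ^ 2)

theorem ContDiffOn.iteratedDeriv_of_isOpen {f : ℝ → ℝ} {S : Set ℝ} (hS : IsOpen S) {k : ℕ∞}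
    (hf : ContDiffOn ℝ ((k + 3 : ℕ∞) : WithTop ℕ∞) f S) :
    ContDiffOn ℝ k (deriv f) S ∧ ContDiffOn ℝ k (iteratedDeriv 2 f) S ∧
      ContDiffOn ℝ k (iteratedDeriv 3 f) S := by
  have e2 : iteratedDeriv 2 f = deriv (deriv f) := by rw [iteratedDeriv_succ, iteratedDeriv_one]
  have e3 : iteratedDeriv 3 f = deriv (iteratedDeriv 2 f) := iteratedDeriv_succ
  have h1 : ContDiffOn ℝ ((k + 2 : ℕ∞) : WithTop ℕ∞) (deriv f) S :=
    hf.deriv_of_isOpen hS (by exact_mod_cast (by rw [add_assoc]; norm_num : k + 2 + 1 ≤ k + 3))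
  have h2 : ContDiffOn ℝ ((k + 1 : ℕ∞) : WithTop ℕ∞) (iteratedDeriv 2 f) S := by
    rw [e2]
    exact h1.deriv_of_isOpen hS
      (by exact_mod_cast (by rw [add_assoc]; norm_num : k + 1 + 1 ≤ k + 2))
  have h3 : ContDiffOn ℝ k (iteratedDeriv 3 f) S := by
    rw [e3]
    exact h2.deriv_of_isOpen hS (by exact_mod_cast le_rfl)
  exact ⟨h1.of_le (by exact_mod_cast le_self_add), h2.of_le (by exact_mod_cast le_self_add), h3⟩

theorem contDiffOn_riccati_coefficients {r t : ℝ → ℝ} {I : Set ℝ} (hI : IsOpen I) {k : ℕ∞}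
    (hr : ContDiffOn ℝ ((k + 3 : ℕ∞) : WithTop ℕ∞) r I)
    (ht : ContDiffOn ℝ ((k + 3 : ℕ∞) : WithTop ℕ∞) t I)
    (hD : ∀ s ∈ I, 1 - deriv r s * deriv t s ≠ 0) :
    ContDiffOn ℝ k (riccatiLinear r t) I ∧ ContDiffOn ℝ k (riccatiConst r t) I := by
  obtain ⟨r1, r2, r3⟩ := ContDiffOn.iteratedDeriv_of_isOpen hI hr
  obtain ⟨t1, t2, t3⟩ := ContDiffOn.iteratedDeriv_of_isOpen hI ht
  have hd : ContDiffOn ℝ k (fun s => 1 - deriv r s * deriv t s) I :=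
    contDiffOn_const.sub (r1.mul t1)
  have c : ∀ x : ℝ, ContDiffOn ℝ k (fun _ : ℝ => x) I := fun x => contDiffOn_const
  refine ⟨(((t2.mul r1).add (t1.mul r2)).div hd hD).neg, ContDiffOn.div ?_
    ((c 8).mul (hd.pow 2)) fun s hs => mul_ne_zero (by norm_num) (pow_ne_zero _ (hD s hs))⟩
  exact ((((((c 2).mul ((r3.mul t1).add (t3.mul r1))).mul hd).add (((c 2).mul r2).mul t2)).add
    (((((c 4).mul r1).mul t1).mul r2).mul t2)).add (((c 3).mul (t1.pow 2)).mul (r2.pow 2))).add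
    (((c 3).mul (r1.pow 2)).mul (t2.pow 2))

open Set in
theorem exists_ricciODE_solution {r t : ℝ → ℝ} {I : Set ℝ} (hI : IsOpen I)
    (hr : ContDiffOn ℝ 3 r I) (ht : ContDiffOn ℝ 3 t I)
    (hD : ∀ s ∈ I, 1 - deriv r s * deriv t s ≠ 0) {s₀ : ℝ} (hs₀ : s₀ ∈ I) (a b : ℝ) :
    ∃ δ > 0, ∃ h : ℝ → ℝ, Ioo (s₀ - δ) (s₀ + δ) ⊆ I ∧
      (∀ k : ℕ∞, ContDiffOn ℝ ((k + 3 : ℕ∞) : WithTop ℕ∞) r I →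
        ContDiffOn ℝ ((k + 3 : ℕ∞) : WithTop ℕ∞) t I →
        ContDiffOn ℝ ((k + 2 : ℕ∞) : WithTop ℕ∞) h (Ioo (s₀ - δ) (s₀ + δ))) ∧
      h s₀ = a ∧ deriv h s₀ = b ∧ ∀ s ∈ Ioo (s₀ - δ) (s₀ + δ), RicciODE r t h s := by
  obtain ⟨hP, hQ⟩ := contDiffOn_riccati_coefficients (k := 0) hI (by simpa using hr)
    (by simpa using ht) hD
  obtain ⟨δ, hδ, w, hδI, hw0, hw⟩ := exists_riccati_solution hI hP.continuousOn hQ.continuousOn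
    hs₀ b
  obtain ⟨h, hh0, hh⟩ := exists_hasDerivAt_Ioo hδ
    (fun s hs => (hw s hs).continuousAt.continuousWithinAt) a
  have hs₀' : s₀ ∈ Ioo (s₀ - δ) (s₀ + δ) := by constructor <;> linarith
  refine ⟨δ, hδ, h, hδI, fun k hrk htk => ?_, hh0, (hh s₀ hs₀').deriv.trans hw0, fun s hs => ?_⟩
  -- The coefficients involve third derivatives of `r` and `t`, hence are `C^k`; then `w` is
  -- `C^{k+1}` and its primitive `h` is `C^{k+2}`.
  · obtain ⟨hPk, hQk⟩ := contDiffOn_riccati_coefficients hI hrk htk hD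
    have h1 := contDiffOn_riccati_solution isOpen_Ioo (hPk.mono hδI) (hQk.mono hδI) hw
    have h2 : ContDiffOn ℝ ((k + 1 : ℕ∞) + 1 : WithTop ℕ∞) h (Ioo (s₀ - δ) (s₀ + δ)) := by
      rw [contDiffOn_succ_iff_deriv_of_isOpen isOpen_Ioo]
      refine ⟨fun s hs => (hh s hs).differentiableAt.differentiableWithinAt, by simp, ?_⟩
      exact ContDiffOn.congr (by exact_mod_cast h1) fun s hs => (hh s hs).deriv
    refine h2.of_le ?_
    exact_mod_cast (by rw [add_assoc]; norm_num : k + 2 ≤ k + 1 + 1)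
  · have h1 : iteratedDeriv 2 h s = w s ^ 2 + riccatiLinear r t s * w s + riccatiConst r t s := by
      rw [iteratedDeriv_succ, iteratedDeriv_one, ← (hw s hs).deriv]
      exact Filter.EventuallyEq.deriv_eq
        (Filter.eventually_of_mem (isOpen_Ioo.mem_nhds hs) fun x hx => (hh x hx).deriv)
    rw [RicciODE, h1, (hh s hs).deriv, deriv_mul_deriv hI ht hr (hδI hs), riccatiLinear,
      riccatiConst]
    ring

/-! ### Conformal flatness, the parallel null field and the signature -/

theorem exp_smul_solMetric {r t h f : ℝ → ℝ} :
    (fun x : Fin 4 → ℝ => Real.exp (2 * f (x 3)) • solMetric r t h x) =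
      solMetric r t (fun s => f s + h s) := by
  ext x i j
  simp only [Matrix.smul_apply, smul_eq_mul, solMetric, Matrix.of_apply, jetMetric]
  rw [← mul_assoc, ← Real.exp_add]
  simp [sec, mul_add]

theorem conformallyFlatOn_solMetric {r t h : ℝ → ℝ} {J : Set ℝ} (hJ : IsOpen J)
    (hr : ContDiffOn ℝ 3 r J) (ht : ContDiffOn ℝ 3 t J)
    (hD : ∀ s ∈ J, 1 - deriv r s * deriv t s ≠ 0) (hh : ContDiffOn ℝ 2 h J)
    (hflat : ∀ s ∈ J, FlatnessODEs r t s) :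
    ConformallyFlatOn (solMetric r t h) (solDomain J) := by
  intro m hm
  -- Any local solution `H` of the Ricci ODE serves, so the initial data are arbitrary. Rescaling by
  -- `f = H - h` replaces `h` by `H`, and the resulting metric is flat.
  obtain ⟨δ, hδ, H, hδJ, hsm, -, -, hode⟩ := exists_ricciODE_solution hJ hr ht hD hm 0 0
  have hH : ContDiffOn ℝ 2 H (Set.Ioo (m 3 - δ) (m 3 + δ)) := by
    simpa using hsm 0 (by simpa using hr) (by simpa using ht)
  refine ⟨solDomain (Set.Ioo (m 3 - δ) (m 3 + δ)), isOpen_solDomain isOpen_Ioo, ?_,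
    fun x hx => hδJ hx, fun x => (fun s => H s - h s) (x 3), ?_, ?_⟩
  · constructor <;> linarith
  · exact (hH.sub (hh.mono hδJ)).comp (contDiff_apply ℝ ℝ (3 : Fin 4)).contDiffOn fun x hx => hx
  · rw [exp_smul_solMetric]
    simp only [sub_add_cancel]
    exact flatOn_solMetric isOpen_Ioo (hr.mono hδJ) (ht.mono hδJ) (fun s hs => hD s (hδJ hs)) hH
      hode fun s hs => hflat s (hδJ hs)

theorem conformallyFlatOn_solMetric_iff {r t h : ℝ → ℝ} {J : Set ℝ} (hJ : IsOpen J)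
    (hr : ContDiffOn ℝ 3 r J) (ht : ContDiffOn ℝ 3 t J)
    (hD : ∀ s ∈ J, 1 - deriv r s * deriv t s ≠ 0) (hh : ContDiffOn ℝ 2 h J) :
    ConformallyFlatOn (solMetric r t h) (solDomain J) ↔ ∀ s ∈ J, FlatnessODEs r t s := by
  refine ⟨fun H s hs => ?_, conformallyFlatOn_solMetric hJ hr ht hD hh⟩
  have hm : Pi.single 3 s ∈ solDomain J := by simpa [solDomain] using hs
  obtain ⟨V, hV, hmV, hVJ, f, hf, hfl⟩ := H _ hm
  simpa using flatnessODEs_of_flatOn hJ hr ht hD hh hV hVJ (hf.differentiableOn (by norm_num)) hfl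
    hmV

theorem isParallelNullOn_solMetric {r t h : ℝ → ℝ} {J : Set ℝ} (hJ : IsOpen J)
    (hr : ContDiffOn ℝ 3 r J) (ht : ContDiffOn ℝ 3 t J)
    (hD : ∀ s ∈ J, 1 - deriv r s * deriv t s ≠ 0) (hh : ContDiffOn ℝ 2 h J) :
    IsParallelNullOn (solMetric r t h) (solDomain J) (fun _ => Pi.single 0 1) := by
  refine ⟨contDiffOn_const, fun m hm => ⟨by simp, ?_, fun i k => ?_⟩⟩
  · simp [solMetric_eq, waveMatrix]
  · simp only [covDeriv, christoffel_solMetric_eq hJ hr ht hD hh hm, solSymbolAt, solSymbol]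
    have : pd i (fun _ : Fin 4 → ℝ => (Pi.single 0 1 : Fin 4 → ℝ) k) m = 0 := by
      simp [pd]
    rw [this]
    fin_cases i <;> fin_cases k <;> simp [waveSymbol, Fin.sum_univ_four]

theorem signature_solMetric {r t h : ℝ → ℝ} {m : Fin 4 → ℝ}
    (hD : 1 - deriv r (m 3) * deriv t (m 3) ≠ 0) :
    (IsSplit (solMetric r t h m) ↔ 0 < 1 - deriv r (m 3) * deriv t (m 3)) ∧
      (IsLorentzian (solMetric r t h m) ↔ 1 - deriv r (m 3) * deriv t (m 3) < 0) := by
  have hE := Real.exp_pos (2 * h (m 3))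
  -- The determinant is `E⁴ D³`, and an odd power of `D` has the sign of `D`.
  have hodd : Odd 3 := by decide
  have := isSplit_isLorentzian_iff_det_sign (M := solMetric r t h m) (v := Pi.single 0 1)
    (by rw [solMetric_eq]; exact waveMatrix_isSymm _ _ _)
    (by
      rw [solMetric_eq, det_waveMatrix]
      exact mul_ne_zero (pow_ne_zero _ hE.ne') (pow_ne_zero _ hD)) (by simp)
    (by simp [solMetric_eq, waveMatrix])
  rw [solMetric_eq, det_waveMatrix] at this
  rw [solMetric_eq, this.1, this.2, mul_pos_iff_of_pos_left (pow_pos hE 4), hodd.pow_pos_iff,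
    ← hodd.pow_neg_iff (a := 1 - deriv r (m 3) * deriv t (m 3))]
  exact ⟨Iff.rfl, fun h => lt_of_not_ge fun h' => h.not_ge (mul_nonneg (pow_pos hE 4).le h'),
    fun h => mul_neg_of_pos_of_neg (pow_pos hE 4) h⟩

/-! ### The projection and the leaves of `H⁺` -/

/-- The differential of `proj` in terms of the coframe, with `r' = r₁`, `t' = t₁`. -/
def projDeriv (r t : ℝ → ℝ) (r₁ t₁ : ℝ) (u v : Fin 6 → ℝ) : Fin 4 → ℝ :=
  ![omega3 u v - u 0 * omega4 r u v - u 1 * omega1 t u v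
      + (r₁ * u 0 ^ 2 / 2 + u 0 * u 1 + t₁ * u 1 ^ 2 / 2) * v 5,
    omega4 r u v - (r₁ * u 0 + u 1) * v 5,
    omega1 t u v - (u 0 + t₁ * u 1) * v 5,
    v 5]

theorem hasDerivWithinAt_proj {r t : ℝ → ℝ} {c : ℝ → Fin 6 → ℝ} {c' : Fin 6 → ℝ} {S : Set ℝ}
    {τ r₁ t₁ : ℝ} (hc : HasDerivWithinAt c c' S τ) (hr : HasDerivAt r r₁ (c τ 5))
    (ht : HasDerivAt t t₁ (c τ 5)) :
    HasDerivWithinAt (fun x => proj r t (c x)) (projDeriv r t r₁ t₁ (c τ) c') S τ := by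
  have h := hasDerivWithinAt_pi.mp hc
  have hrc : HasDerivWithinAt (fun x => r (c x 5)) (r₁ * c' 5) S τ :=
    hr.comp_hasDerivWithinAt τ (h 5)
  have htc : HasDerivWithinAt (fun x => t (c x 5)) (t₁ * c' 5) S τ :=
    ht.comp_hasDerivWithinAt τ (h 5)
  rw [hasDerivWithinAt_pi]
  intro i
  fin_cases i
  · exact ((((h 2).sub ((h 0).mul (h 3))).sub ((h 1).mul (h 4))).add
      ((((hrc.mul ((h 0).pow 2)).div_const 2).add (((h 5).mul (h 0)).mul (h 1))).add
      ((htc.mul ((h 1).pow 2)).div_const 2))).congr_deriv (by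
        simp [projDeriv, omega1, omega3, omega4]; ring)
  · exact (((h 3).sub (hrc.mul (h 0))).sub ((h 5).mul (h 1))).congr_deriv (by
      simp [projDeriv, omega4]; ring)
  · exact (((h 4).sub ((h 5).mul (h 0))).sub (htc.mul (h 1))).congr_deriv (by
      simp [projDeriv, omega1]; ring)
  · exact (h 5).congr_deriv (by simp [projDeriv])

theorem contDiffAt_proj {r t : ℝ → ℝ} {n : WithTop ℕ∞} {u : Fin 6 → ℝ}
    (hr : ContDiffAt ℝ n r (u 5)) (ht : ContDiffAt ℝ n t (u 5)) : ContDiffAt ℝ n (proj r t) u := by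
  have h : ∀ i : Fin 6, ContDiffAt ℝ n (fun x : Fin 6 → ℝ => x i) u := fun i =>
    (contDiff_apply ℝ ℝ i).contDiffAt
  have hrc : ContDiffAt ℝ n (fun x : Fin 6 → ℝ => r (x 5)) u := hr.comp u (h 5)
  have htc : ContDiffAt ℝ n (fun x : Fin 6 → ℝ => t (x 5)) u := ht.comp u (h 5)
  rw [contDiffAt_pi]
  intro i
  fin_cases i
  · exact (((h 2).sub ((h 0).mul (h 3))).sub ((h 1).mul (h 4))).add
      ((((hrc.mul ((h 0).pow 2)).div_const 2).add (((h 5).mul (h 0)).mul (h 1))).add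
      ((htc.mul ((h 1).pow 2)).div_const 2))
  · exact ((h 3).sub (hrc.mul (h 0))).sub ((h 5).mul (h 1))
  · exact ((h 4).sub ((h 5).mul (h 0))).sub (htc.mul (h 1))
  · exact h 5

theorem fderiv_proj {r t : ℝ → ℝ} {u : Fin 6 → ℝ}
    (hr : ContDiffAt ℝ 1 r (u 5)) (ht : ContDiffAt ℝ 1 t (u 5)) (v : Fin 6 → ℝ) :
    fderiv ℝ (proj r t) u v = projDeriv r t (deriv r (u 5)) (deriv t (u 5)) u v := by
  -- The differential is read off from the derivative along a straight line, so the computation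
  -- along curves is reused.
  have hc : HasDerivAt (fun τ : ℝ => u + τ • v) v 0 := by
    simpa using ((hasDerivAt_id (0 : ℝ)).smul_const v).const_add u
  have hu : u + (0 : ℝ) • v = u := by simp
  have h1 := hasDerivWithinAt_proj (r := r) (t := t) (r₁ := deriv r (u 5)) (t₁ := deriv t (u 5))
    (hasDerivWithinAt_univ.mpr hc)
    (by rw [hu]; exact (hr.differentiableAt (by norm_num)).hasDerivAt)
    (by rw [hu]; exact (ht.differentiableAt (by norm_num)).hasDerivAt)
  rw [hasDerivWithinAt_univ, hu] at h1
  have h2 : HasFDerivAt (proj r t) (fderiv ℝ (proj r t) u) (u + (0 : ℝ) • v) := by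
    rw [hu]
    exact ((contDiffAt_proj hr ht).differentiableAt (by norm_num)).hasFDerivAt
  have h3 : HasDerivAt (fun τ : ℝ => proj r t (u + τ • v)) (fderiv ℝ (proj r t) u v) 0 :=
    HasFDerivAt.comp_hasDerivAt (f := fun τ : ℝ => u + τ • v) (l := proj r t) (0 : ℝ) h2 hc
  exact h3.unique h1

/-- The components are triangular in the coframe: `ds = 0` forces `ω₄ = ω₁ = 0` and then `ω₃ = 0`,
which are the equations of `H⁺`. -/
theorem projDeriv_eq_zero_iff {r t : ℝ → ℝ} {r₁ t₁ : ℝ} {u v : Fin 6 → ℝ} :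
    projDeriv r t r₁ t₁ u v = 0 ↔ v ∈ Submodule.span ℝ {totalDx r u, totalDy t u} := by
  rw [Submodule.mem_span_pair]
  constructor
  · intro h
    have h0 := congrFun h 0
    have h1 := congrFun h 1
    have h2 := congrFun h 2
    have h3 := congrFun h 3
    simp only [projDeriv, omega1, omega3, omega4, Matrix.cons_val, Pi.zero_apply] at h0 h1 h2 h3
    rw [h3] at h0 h1 h2
    refine ⟨v 0, v 1, ?_⟩
    ext i
    fin_cases i <;> simp [totalDx, totalDy]
    · linear_combination -h0 - u 0 * h1 - u 1 * h2
    · linear_combination -h1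
    · linear_combination -h2
    · exact h3.symm
  · rintro ⟨a, b, rfl⟩
    ext i
    fin_cases i <;> simp [projDeriv, omega1, omega3, omega4, totalDx, totalDy] <;> ring

theorem projDeriv_surjective (r t : ℝ → ℝ) (r₁ t₁ : ℝ) (u : Fin 6 → ℝ) :
    Function.Surjective (projDeriv r t r₁ t₁ u) := by
  intro w
  -- A preimage with vanishing `dx` and `dy` is found by back substitution, starting from `ds`.
  refine ⟨![0, 0, w 0 + u 0 * (w 1 + (r₁ * u 0 + u 1) * w 3) + u 1 * (w 2 + (u 0 + t₁ * u 1) * w 3)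
    - (r₁ * u 0 ^ 2 / 2 + u 0 * u 1 + t₁ * u 1 ^ 2 / 2) * w 3, w 1 + (r₁ * u 0 + u 1) * w 3,
    w 2 + (u 0 + t₁ * u 1) * w 3, w 3], ?_⟩
  ext i
  fin_cases i <;> simp [projDeriv, omega1, omega3, omega4]
  ring

theorem projDeriv_single (r t : ℝ → ℝ) (r₁ t₁ : ℝ) (u : Fin 6 → ℝ) :
    projDeriv r t r₁ t₁ u (Pi.single 2 1) = Pi.single 0 1 := by
  ext i
  fin_cases i <;> simp [projDeriv, omega1, omega3, omega4]

/-- The multiples of `ω₂` in the differential of `proj` cancel: the cross terms `ω₂ω₁`, `ω₂ω₄` and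
the `ω₂²` term sum to zero because the coefficient of `2ω₂ω₃` is exactly `1 - r't'`. -/
theorem jetMetric_eq (r t h : ℝ → ℝ) (u v w : Fin 6 → ℝ) :
    jetMetric r t h u v w = projDeriv r t (deriv r (u 5)) (deriv t (u 5)) u v ⬝ᵥ
      (solMetric r t h (proj r t u)).mulVec
        (projDeriv r t (deriv r (u 5)) (deriv t (u 5)) u w) := by
  have h5 : proj r t u 3 = u 5 := rfl
  rw [solMetric_eq, h5]
  simp only [jetMetric, jetForm, omega2, projDeriv]
  generalize omega1 t u v = v1, omega1 t u w = w1, omega3 u v = v3, omega3 u w = w3,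
    omega4 r u v = v4, omega4 r u w = w4
  simp [waveMatrix, Matrix.mulVec, dotProduct, Fin.sum_univ_four]
  ring

/-- The point of the leaf over `m` with the given values of `x` and `y`. -/
def leafPoint (r t : ℝ → ℝ) (m : Fin 4 → ℝ) (x y : ℝ) : Fin 6 → ℝ :=
  ![x, y, m 0 + x * m 1 + y * m 2 + (r (m 3) * x ^ 2 / 2 + m 3 * x * y + t (m 3) * y ^ 2 / 2),
    m 1 + r (m 3) * x + m 3 * y, m 2 + m 3 * x + t (m 3) * y, m 3]

theorem leafPoint_proj (r t : ℝ → ℝ) (u : Fin 6 → ℝ) :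
    leafPoint r t (proj r t u) (u 0) (u 1) = u := by
  ext i
  fin_cases i <;> simp [leafPoint, proj] <;> ring

theorem proj_sec (r t : ℝ → ℝ) (m : Fin 4 → ℝ) : proj r t (sec m) = m := by
  ext i
  fin_cases i <;> simp [proj, sec]

theorem hasDerivAt_leafPoint (r t : ℝ → ℝ) (m : Fin 4 → ℝ) {x y : ℝ → ℝ} {x' y' τ : ℝ}
    (hx : HasDerivAt x x' τ) (hy : HasDerivAt y y' τ) :
    HasDerivAt (fun τ => leafPoint r t m (x τ) (y τ))
      (x' • totalDx r (leafPoint r t m (x τ) (y τ))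
        + y' • totalDy t (leafPoint r t m (x τ) (y τ))) τ := by
  rw [hasDerivAt_pi]
  intro i
  fin_cases i
  · exact hx.congr_deriv (by simp [totalDx, totalDy])
  · exact hy.congr_deriv (by simp [totalDx, totalDy])
  · exact ((((hx.mul_const (m 1)).const_add (m 0)).add (hy.mul_const (m 2))).add
      (((((hx.pow 2).const_mul (r (m 3))).div_const 2).add ((hx.const_mul (m 3)).mul hy)).add
        (((hy.pow 2).const_mul (t (m 3))).div_const 2))).congr_deriv (by
        simp [totalDx, totalDy, leafPoint]; ring)
  · exact (((hx.const_mul (r (m 3))).const_add (m 1)).add (hy.const_mul (m 3))).congr_deriv (by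
      simp [totalDx, totalDy, leafPoint]; ring)
  · exact (((hx.const_mul (m 3)).const_add (m 2)).add (hy.const_mul (t (m 3)))).congr_deriv (by
      simp [totalDx, totalDy, leafPoint]; ring)
  · exact (hasDerivAt_const τ (m 3)).congr_deriv (by simp [totalDx, totalDy])

/-- Points with the same image are joined by lifting the segment between their `(x, y)` values to
the leaf. Conversely, `proj` has zero derivative along any curve tangent to `H⁺`. -/
theorem proj_eq_iff_sameLeaf {r t : ℝ → ℝ} {I : Set ℝ} (hr : ∀ s ∈ I, DifferentiableAt ℝ r s)
    (ht : ∀ s ∈ I, DifferentiableAt ℝ t s) {u u' : Fin 6 → ℝ} (hu : u ∈ jetDomain I) :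
    proj r t u = proj r t u' ↔ SameLeaf r t I u u' := by
  constructor
  · intro h
    refine ⟨fun τ => leafPoint r t (proj r t u) (u 0 + τ * (u' 0 - u 0)) (u 1 + τ * (u' 1 - u 1)),
      fun _ => u' 0 - u 0, fun _ => u' 1 - u 1, continuous_const, continuous_const, ?_, ?_,
      fun τ _ => ⟨hu, ?_⟩⟩
    · simp [leafPoint_proj]
    · simp [h, leafPoint_proj]
    · have hl : ∀ a b : ℝ, HasDerivAt (fun τ : ℝ => a + τ * b) b τ := fun a b => by
        simpa using ((hasDerivAt_id τ).mul_const b).const_add a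
      exact (hasDerivAt_leafPoint r t (proj r t u) (hl _ _) (hl _ _)).hasDerivWithinAt
  · rintro ⟨c, a, b, -, -, rfl, rfl, hc⟩
    have hd : ∀ τ ∈ Set.Icc (0 : ℝ) 1,
        HasDerivWithinAt (fun τ => proj r t (c τ)) 0 (Set.Icc 0 1) τ := by
      intro τ hτ
      obtain ⟨hm, hcd⟩ := hc τ hτ
      refine (hasDerivWithinAt_proj hcd (hr _ hm).hasDerivAt (ht _ hm).hasDerivAt).congr_deriv ?_
      exact projDeriv_eq_zero_iff.mpr (Submodule.mem_span_pair.mpr ⟨a τ, b τ, rfl⟩)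
    exact (constant_of_derivWithin_zero (fun τ hτ => (hd τ hτ).differentiableWithinAt)
      (fun τ hτ => (hd τ (Set.Ico_subset_Icc_self hτ)).derivWithin
        (uniqueDiffOn_Icc one_pos τ (Set.Ico_subset_Icc_self hτ))) 1
      (Set.right_mem_Icc.mpr zero_le_one)).symm

/-! ### The example `r = s²`, `t = s` -/

theorem deriv_sq_id (s : ℝ) : deriv (fun x : ℝ => x ^ 2) s = 2 * s := by simp

/-- For `r = s²`, `t = s` the metric is not conformally flat on any non-empty open set. -/
theorem not_conformallyFlatOn_sq {h : ℝ → ℝ} {J : Set ℝ} (hJ : IsOpen J)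
    (hD : ∀ s ∈ J, 1 - deriv (fun x : ℝ => x ^ 2) s * deriv (fun x : ℝ => x) s ≠ 0)
    (hh : ContDiffOn ℝ 2 h J) {V : Set (Fin 4 → ℝ)} (hne : V.Nonempty) (hVJ : V ⊆ solDomain J) :
    ¬ ConformallyFlatOn (solMetric (fun x => x ^ 2) (fun x => x) h) V := by
  intro H
  obtain ⟨m, hm⟩ := hne
  obtain ⟨W, hW, hmW, hWV, f, hf, hfl⟩ := H m hm
  have hr : ContDiffOn ℝ 3 (fun x : ℝ => x ^ 2) J := (contDiff_id.pow 2).contDiffOn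
  have ht : ContDiffOn ℝ 3 (fun x : ℝ => x) J := contDiff_id.contDiffOn
  have h1 := (flatnessODEs_of_flatOn hJ hr ht hD hh hW (hWV.trans hVJ) (hf.differentiableOn (by norm_num)) hfl hmW).1
  have hDm := hD _ (hVJ hm)
  have e1 : deriv (fun x : ℝ => x ^ 2) = fun s => 2 * s := funext deriv_sq_id
  have e2 : iteratedDeriv 2 (fun x : ℝ => x ^ 2) = fun _ => 2 := by
    rw [iteratedDeriv_succ, iteratedDeriv_one, e1]
    ext s
    simp
  have e3 : iteratedDeriv 3 (fun x : ℝ => x ^ 2) = fun _ => 0 := by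
    rw [iteratedDeriv_succ, e2]
    simp
  rw [e1] at hDm
  rw [e1, e2, e3] at h1
  simp only [deriv_id'', mul_one] at h1 hDm
  have e4 : deriv (fun x : ℝ => 2 * x) (m 3) = 2 := by simp
  -- Here `r''' = 0`, while the right-hand side of the first flatness ODE is `-6 / (1 - 2s)`, which
  -- never vanishes.
  rw [e4, eq_comm, div_eq_zero_iff] at h1
  rcases h1 with h1 | h1
  · norm_num at h1
  · exact hDm (by linarith)

theorem exists_ricciFlat_sq {I : Set ℝ} (hI : IsOpen I)
    (hD : ∀ s ∈ I, 1 - deriv (fun x : ℝ => x ^ 2) s * deriv (fun x : ℝ => x) s ≠ 0)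
    {s₀ : ℝ} (hs₀ : s₀ ∈ I) :
    ∃ (h : ℝ → ℝ) (c d : ℝ), c < d ∧ Set.Ioo c d ⊆ I ∧
      ContDiffOn ℝ (⊤ : ℕ∞) h (Set.Ioo c d) ∧
      IsMetricOn (solMetric (fun x => x ^ 2) (fun x => x) h) (solDomain (Set.Ioo c d)) ∧
      IsParallelNullOn (solMetric (fun x => x ^ 2) (fun x => x) h) (solDomain (Set.Ioo c d))
        (fun _ => Pi.single 0 1) ∧
      RicciFlatOn (solMetric (fun x => x ^ 2) (fun x => x) h) (solDomain (Set.Ioo c d)) ∧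
      ∀ V : Set (Fin 4 → ℝ), IsOpen V → V.Nonempty → V ⊆ solDomain (Set.Ioo c d) →
        ¬ ConformallyFlatOn (solMetric (fun x => x ^ 2) (fun x => x) h) V := by
  have hr : ∀ (n : WithTop ℕ∞) (S : Set ℝ), ContDiffOn ℝ n (fun x : ℝ => x ^ 2) S := fun n S =>
    (contDiff_id.pow 2).contDiffOn
  have ht : ∀ (n : WithTop ℕ∞) (S : Set ℝ), ContDiffOn ℝ n (fun x : ℝ => x) S := fun n S =>
    contDiff_id.contDiffOn
  obtain ⟨δ, hδ, h, hδI, hsm, -, -, hode⟩ :=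
    exists_ricciODE_solution hI (hr _ _) (ht _ _) hD hs₀ 0 0
  have hsmooth : ContDiffOn ℝ (⊤ : ℕ∞) h (Set.Ioo (s₀ - δ) (s₀ + δ)) := by
    simpa using hsm ⊤ (hr _ _) (ht _ _)
  have hh : ContDiffOn ℝ 2 h (Set.Ioo (s₀ - δ) (s₀ + δ)) :=
    contDiffOn_infty.mp hsmooth 2
  have hD' := fun s hs => hD s (hδI hs)
  exact ⟨h, s₀ - δ, s₀ + δ, by linarith, hδI, hsmooth,
    isMetricOn_solMetric isOpen_Ioo (hr _ _) (ht _ _) hD' hh,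
    isParallelNullOn_solMetric isOpen_Ioo (hr _ _) (ht _ _) hD' hh,
    (ricciFlatOn_solMetric_iff isOpen_Ioo (hr _ _) (ht _ _) hD' hh).mpr hode,
    fun V _ hne hV => not_conformallyFlatOn_sq isOpen_Ioo hD' hh hne hV⟩

end ParaCR

end

theorem mainTheorem12 :
    (∀ (I : Set ℝ) (r t : ℝ → ℝ), IsOpen I → ContDiffOn ℝ 3 r I → ContDiffOn ℝ 3 t I →
      (∀ s ∈ I, 1 - deriv r s * deriv t s ≠ 0) →
      -- `proj` is the quotient map of the jet space onto the space of leaves of `H⁺`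
      (∀ u ∈ jetDomain I, ContDiffAt ℝ 3 (proj r t) u ∧
        LinearMap.ker (fderiv ℝ (proj r t) u).toLinearMap
          = Submodule.span ℝ {totalDx r u, totalDy t u} ∧
        Function.Surjective (fderiv ℝ (proj r t) u) ∧
        fderiv ℝ (proj r t) u (Pi.single 2 1) = Pi.single 0 1) ∧
      proj r t '' jetDomain I = solDomain I ∧
      (∀ u ∈ jetDomain I, ∀ u' ∈ jetDomain I,
        proj r t u = proj r t u' ↔ SameLeaf r t I u u') ∧
      -- the metrics `e^{2h} g₀`
      (∀ (J : Set ℝ) (h : ℝ → ℝ), IsOpen J → J ⊆ I → ContDiffOn ℝ 2 h J →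
        -- the form on the jet space descends to `solMetric` on the solution space
        (∀ u ∈ jetDomain J, ∀ v w : Fin 6 → ℝ,
          jetMetric r t h u v w =
            fderiv ℝ (proj r t) u v ⬝ᵥ
              (solMetric r t h (proj r t u)).mulVec (fderiv ℝ (proj r t) u w)) ∧
        IsMetricOn (solMetric r t h) (solDomain J) ∧
        (∀ m ∈ solDomain J,
          (IsSplit (solMetric r t h m) ↔ 0 < 1 - deriv r (m 3) * deriv t (m 3)) ∧
          (IsLorentzian (solMetric r t h m) ↔ 1 - deriv r (m 3) * deriv t (m 3) < 0)) ∧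
        -- the vector field `∂_z` is null and covariantly constant
        IsParallelNullOn (solMetric r t h) (solDomain J) (fun _ => Pi.single 0 1) ∧
        (RicciFlatOn (solMetric r t h) (solDomain J) ↔ ∀ s ∈ J, RicciODE r t h s) ∧
        (ConformallyFlatOn (solMetric r t h) (solDomain J) ↔ ∀ s ∈ J, FlatnessODEs r t s)) ∧
      -- existence of `h` near every `s₀`, with arbitrary initial data
      (∀ s₀ ∈ I, ∀ a b : ℝ, ∃ δ > 0, ∃ h : ℝ → ℝ,
        Set.Ioo (s₀ - δ) (s₀ + δ) ⊆ I ∧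
        ContDiffOn ℝ 2 h (Set.Ioo (s₀ - δ) (s₀ + δ)) ∧
        (∀ k : ℕ∞, ContDiffOn ℝ ((k + 3 : ℕ∞) : WithTop ℕ∞) r I →
          ContDiffOn ℝ ((k + 3 : ℕ∞) : WithTop ℕ∞) t I →
          ContDiffOn ℝ ((k + 2 : ℕ∞) : WithTop ℕ∞) h (Set.Ioo (s₀ - δ) (s₀ + δ))) ∧
        h s₀ = a ∧ deriv h s₀ = b ∧
        (∀ s ∈ Set.Ioo (s₀ - δ) (s₀ + δ), RicciODE r t h s) ∧
        RicciFlatOn (solMetric r t h) (solDomain (Set.Ioo (s₀ - δ) (s₀ + δ))))) ∧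
    -- Ricci-flat, nowhere conformally flat pp-waves of this form
    (∃ r t h : ℝ → ℝ, ∃ c d : ℝ, c < d ∧ ContDiff ℝ ∞ r ∧ ContDiff ℝ ∞ t ∧
      ContDiffOn ℝ ∞ h (Set.Ioo c d) ∧
      (∀ s ∈ Set.Ioo c d, 1 - deriv r s * deriv t s < 0) ∧
      IsPPWaveOn (solMetric r t h) (solDomain (Set.Ioo c d)) ∧
      RicciFlatOn (solMetric r t h) (solDomain (Set.Ioo c d)) ∧
      ∀ V : Set (Fin 4 → ℝ), IsOpen V → V.Nonempty → V ⊆ solDomain (Set.Ioo c d) →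
        ¬ ConformallyFlatOn (solMetric r t h) V) ∧
    -- and their split-signature analogues
    (∃ r t h : ℝ → ℝ, ∃ c d : ℝ, c < d ∧ ContDiff ℝ ∞ r ∧ ContDiff ℝ ∞ t ∧
      ContDiffOn ℝ ∞ h (Set.Ioo c d) ∧
      (∀ s ∈ Set.Ioo c d, 0 < 1 - deriv r s * deriv t s) ∧
      IsSplitPPWaveOn (solMetric r t h) (solDomain (Set.Ioo c d)) ∧
      RicciFlatOn (solMetric r t h) (solDomain (Set.Ioo c d)) ∧
      ∀ V : Set (Fin 4 → ℝ), IsOpen V → V.Nonempty → V ⊆ solDomain (Set.Ioo c d) →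
        ¬ ConformallyFlatOn (solMetric r t h) V) := by
  refine ⟨fun I r t hI hr ht hD => ?_, ?_, ?_⟩
  · have hrI : ∀ s ∈ I, ContDiffAt ℝ 3 r s := fun s hs => hr.contDiffAt (hI.mem_nhds hs)
    have htI : ∀ s ∈ I, ContDiffAt ℝ 3 t s := fun s hs => ht.contDiffAt (hI.mem_nhds hs)
    have hfd : ∀ u ∈ jetDomain I, ∀ v, fderiv ℝ (proj r t) u v =
        projDeriv r t (deriv r (u 5)) (deriv t (u 5)) u v := fun u hu v =>
      fderiv_proj ((hrI _ hu).of_le (by norm_num)) ((htI _ hu).of_le (by norm_num)) v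
    refine ⟨fun u hu => ⟨contDiffAt_proj (hrI _ hu) (htI _ hu), ?_, fun w => ?_, ?_⟩, ?_,
      fun u hu u' _ => proj_eq_iff_sameLeaf
        (fun s hs => (hrI s hs).differentiableAt (by norm_num))
        (fun s hs => (htI s hs).differentiableAt (by norm_num)) hu,
      fun J h hJ hJI hh => ?_, fun s₀ hs₀ a b => ?_⟩
    · ext v
      rw [LinearMap.mem_ker, ← projDeriv_eq_zero_iff (r₁ := deriv r (u 5)) (t₁ := deriv t (u 5)),
        ← hfd u hu]
      rfl
    · obtain ⟨v, hv⟩ := projDeriv_surjective r t (deriv r (u 5)) (deriv t (u 5)) u w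
      exact ⟨v, (hfd u hu v).trans hv⟩
    · rw [hfd u hu, projDeriv_single]
    · ext m
      constructor
      · rintro ⟨u, hu, rfl⟩
        exact hu
      · exact fun hm => ⟨sec m, hm, proj_sec r t m⟩
    · have hrJ := hr.mono hJI
      have htJ := ht.mono hJI
      have hDJ : ∀ s ∈ J, 1 - deriv r s * deriv t s ≠ 0 := fun s hs => hD s (hJI hs)
      refine ⟨fun u hu v w => ?_, isMetricOn_solMetric hJ hrJ htJ hDJ hh,
        fun m hm => signature_solMetric (hDJ _ hm), isParallelNullOn_solMetric hJ hrJ htJ hDJ hh,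
        ricciFlatOn_solMetric_iff hJ hrJ htJ hDJ hh,
        conformallyFlatOn_solMetric_iff hJ hrJ htJ hDJ hh⟩
      rw [hfd u (hJI hu), hfd u (hJI hu)]
      exact jetMetric_eq r t h u v w
    · obtain ⟨δ, hδ, h, hδI, hsm, ha, hb, hode⟩ := exists_ricciODE_solution hI hr ht hD hs₀ a b
      have hh : ContDiffOn ℝ 2 h (Set.Ioo (s₀ - δ) (s₀ + δ)) := by
        simpa using hsm 0 (by simpa using hr) (by simpa using ht)
      exact ⟨δ, hδ, h, hδI, hh, hsm, ha, hb, hode,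
        (ricciFlatOn_solMetric_iff isOpen_Ioo (hr.mono hδI) (ht.mono hδI)
          (fun s hs => hD s (hδI hs)) hh).mpr hode⟩
  -- Since `D = 1 - 2s`, the base point `s₀ = 1` gives the Lorentzian example and `s₀ = 0`, used
  -- below, the split one.
  · have hneg : ∀ s ∈ Set.Ioi (1 / 2 : ℝ),
        1 - deriv (fun x : ℝ => x ^ 2) s * deriv (fun x : ℝ => x) s < 0 := by
      intro s hs
      rw [deriv_sq_id, deriv_id'']
      linarith [Set.mem_Ioi.mp hs]
    obtain ⟨h, c, d, hcd, hI, hsm, hmet, hpar, hric, hconf⟩ := exists_ricciFlat_sq isOpen_Ioi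
      (fun s hs => (hneg s hs).ne) (s₀ := 1) (by norm_num [Set.mem_Ioi])
    exact ⟨fun x => x ^ 2, fun x => x, h, c, d, hcd, contDiff_id.pow 2, contDiff_id, hsm,
      fun s hs => hneg s (hI hs), ⟨hmet, fun m hm =>
        (signature_solMetric (hneg _ (hI hm)).ne).2.mpr (hneg _ (hI hm)), _, hpar⟩, hric, hconf⟩
  · have hpos : ∀ s ∈ Set.Iio (1 / 2 : ℝ),
        0 < 1 - deriv (fun x : ℝ => x ^ 2) s * deriv (fun x : ℝ => x) s := by
      intro s hs
      rw [deriv_sq_id, deriv_id'']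
      linarith [Set.mem_Iio.mp hs]
    obtain ⟨h, c, d, hcd, hI, hsm, hmet, hpar, hric, hconf⟩ := exists_ricciFlat_sq isOpen_Iio
      (fun s hs => (hpos s hs).ne') (s₀ := 0) (by norm_num [Set.mem_Iio])
    exact ⟨fun x => x ^ 2, fun x => x, h, c, d, hcd, contDiff_id.pow 2, contDiff_id, hsm,
      fun s hs => hpos s (hI hs), ⟨hmet, fun m hm =>
        (signature_solMetric (hpos _ (hI hm)).ne').1.mpr (hpos _ (hI hm)), _, hpar⟩, hric, hconf⟩
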